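/- **Setting.** Let $L_1,L_2,T,K_1,K_2>0$, $\beta,\gamma\in(1,2)$, let $J,M_1,M_2,N\ge 1$ be integers, and put $h_1=L_1/M_1$, $h_2=L_2/M_2$, $\tau=T/N$. Let $f:\mathbb R^3\to\mathbb R$ and $\phi:\mathbb R^2\to\mathbb R$ be arbitrary. Let $\omega\ge 0$ be a weight function on $[0,1]$; put $\alpha_r=\frac{r}{2J}$ and $\lambda_r=d_r\,\omega(\alpha_r)\frac1{2J}$ for $0\le r\le m:=2J$, where $d_0=d_{2J}=\frac12$ and $d_r=1$ otherwise, and assume that $\omega(\alpha_r)>0$ for at least one $r<2J$. Let $\sigma$ be the positive root of $$F(\sigma)=\sum_{r=0}^{m}\frac{\lambda_r}{\Gamma(3-\alpha_r)}\,\sigma^{1-\alpha_r}\Big[\sigma-\Big(1-\frac{\alpha_r}2\Big)\Big]\tau^{2-\alpha_r}=0 .$$ For $\alpha\in[0,1]$ put $a_0^{(\alpha)}=\sigma^{1-\alpha}$ and, for $l\ge1$, $$a_l^{(\alpha)}=(l+\sigma)^{1-\alpha}-(l-1+\sigma)^{1-\alpha},$$ $$b_l^{(\alpha)}=\tfrac1{2-\alpha}\big[(l+\sigma)^{2-\alpha}-(l-1+\sigma)^{2-\alpha}\big]-\tfrac12\big[(l+\sigma)^{1-\alpha}+(l-1+\sigma)^{1-\alpha}\big].$$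 Let $c_0^{(1,\alpha)}=a_0^{(\alpha)}$ and, for $n\ge2$, $c_0^{(n,\alpha)}=a_0^{(\alpha)}+b_1^{(\alpha)}$, $c_k^{(n,\alpha)}=a_k^{(\alpha)}+b_{k+1}^{(\alpha)}-b_k^{(\alpha)}$ for $1\le k\le n-2$, $c_{n-1}^{(n,\alpha)}=a_{n-1}^{(\alpha)}-b_{n-1}^{(\alpha)}$. Let $$\hat c_k^{(n)}=\sum_{r=0}^m\lambda_r\frac{\tau^{-\alpha_r}}{\Gamma(2-\alpha_r)}c_k^{(n,\alpha_r)},\qquad g_k^{(\beta)}=\frac{(-1)^k\,\Gamma(\beta+1)}{\Gamma(\beta/2-k+1)\,\Gamma(\beta/2+k+1)}\quad(k\in\mathbb Z),$$ $$c_*^{(\beta)}=\frac2\beta\,e^{-2}\,\frac{(4-\beta)(2-\beta)\beta}{(6+\beta)(4+\beta)(2+\beta)}\cdot\frac{\Gamma(\beta+1)}{\Gamma(\beta/2+1)^2}\Big(3+\frac\beta2\Big)^{\beta+1},$$ and likewise for $\gamma$. **Scheme.** Let $f_{ij}^{n-1+\sigma}=f\big(ih_1,jh_2,(n-1+\sigma)\tau\big)$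 and let $u_{ij}^n$ ($0\le i\le M_1$, $0\le j\le M_2$, $0\le n\le N$) satisfy, for $1\le i\le M_1-1$, $1\le j\le M_2-1$, $1\le n\le N$, $$\sum_{k=0}^{n-1}\hat c_k^{(n)}\big(u_{ij}^{n-k}-u_{ij}^{n-k-1}\big)=-K_1h_1^{-\beta}\sum_{k=i-M_1}^{i}g_k^{(\beta)}\big[\sigma u_{i-k,j}^n+(1-\sigma)u_{i-k,j}^{n-1}\big]-K_2h_2^{-\gamma}\sum_{k=j-M_2}^{j}g_k^{(\gamma)}\big[\sigma u_{i,j-k}^n+(1-\sigma)u_{i,j-k}^{n-1}\big]+f_{ij}^{n-1+\sigma},$$ with $u_{ij}^n=0$ for $0\le n\le N$ whenever $i\in\{0,M_1\}$ or $j\in\{0,M_2\}$, and $u_{ij}^0=\phi(ih_1,jh_2)$ for $1\le i\le M_1-1$, $1\le j\le M_2-1$. Write $\|v\|^2=h_1h_2\sum_{i=1}^{M_1-1}\sum_{j=1}^{M_2-1}v_{ij}^2$. **Theorem (unconditional stability).** For every $1\le n\le N$, $$\|u^n\|^2\le\|u^0\|^2+\frac14\left[\frac{(2L_1)^\beta}{K_1c_*^{(\beta)}}+\frac{(2L_2)^\gamma}{K_2c_*^{(\gamma)}}\right]\frac{1}{\displaystyle\sum_{r=0}^m\frac{\lambda_r}{T^{\alpha_r}\Gamma(1-\alpha_r)}}\;\max_{1\le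 l\le n}\|f^{l-1+\sigma}\|^2,$$ where the term $r=m$ (with $\alpha_m=1$) of the sum in the denominator is $0$, by the convention $1/\Gamma(0)=0$. -/

import Mathlib

noncomputable section

namespace TDRFDE

/-! Composite trapezoid rule in the order variable, with `2 * J` subintervals of `[0, 1]`. -/

/-- The node `α_r = r / (2J)`. -/
def node (J r : ℕ) : ℝ := (r : ℝ) / (2 * (J : ℝ))

/-- The trapezoid weight `d_r`: `1/2` at the two end nodes, `1` otherwise. -/
def trapWeight (J r : ℕ) : ℝ := if r = 0 ∨ r = 2 * J then 1 / 2 else 1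

/-- `λ_r = d_r ω(α_r) Δα` with `Δα = 1 / (2J)`. -/
def lam (J : ℕ) (w : ℝ → ℝ) (r : ℕ) : ℝ :=
  trapWeight J r * w (node J r) * (1 / (2 * (J : ℝ)))

/-- `F(σ) = ∑_r λ_r / Γ(3 - α_r) σ^{1 - α_r} [σ - (1 - α_r / 2)] τ^{2 - α_r}`. -/
def F (J : ℕ) (w : ℝ → ℝ) (τ σ : ℝ) : ℝ :=
  ∑ r ∈ Finset.range (2 * J + 1),
    lam J w r / Real.Gamma (3 - node J r) * σ ^ (1 - node J r)
      * (σ - (1 - node J r / 2)) * τ ^ (2 - node J r)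

/-! Coefficients of the time discretization. -/

/-- `a_0 = σ^{1-α}` and `a_l = (l+σ)^{1-α} - (l-1+σ)^{1-α}` for `l ≥ 1`. -/
def aCoeff (σ α : ℝ) (l : ℕ) : ℝ :=
  if l = 0 then σ ^ (1 - α)
  else ((l : ℝ) + σ) ^ (1 - α) - ((l : ℝ) - 1 + σ) ^ (1 - α)

/-- The coefficient `b_l`, used for `l ≥ 1` only. -/
def bCoeff (σ α : ℝ) (l : ℕ) : ℝ :=
  1 / (2 - α) * (((l : ℝ) + σ) ^ (2 - α) - ((l : ℝ) - 1 + σ) ^ (2 - α))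
    - 1 / 2 * (((l : ℝ) + σ) ^ (1 - α) + ((l : ℝ) - 1 + σ) ^ (1 - α))

/-- The coefficient `c_k^{(n,α)}`, used for `0 ≤ k ≤ n - 1`. -/
def cCoeff (σ α : ℝ) (n k : ℕ) : ℝ :=
  if n = 1 then aCoeff σ α 0
  else if k = 0 then aCoeff σ α 0 + bCoeff σ α 1
  else if k + 2 ≤ n then aCoeff σ α k + bCoeff σ α (k + 1) - bCoeff σ α k
  else aCoeff σ α k - bCoeff σ α k

/-- `ĉ_k^{(n)} = ∑_r λ_r τ^{-α_r} / Γ(2 - α_r) c_k^{(n,α_r)}`. -/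
def cHat (J : ℕ) (w : ℝ → ℝ) (τ σ : ℝ) (n k : ℕ) : ℝ :=
  ∑ r ∈ Finset.range (2 * J + 1),
    lam J w r * (τ ^ (-node J r) / Real.Gamma (2 - node J r)) * cCoeff σ (node J r) n k

/-! Fractional centred differences. -/

/-- `g_k^{(β)} = (-1)^k Γ(β+1) / (Γ(β/2-k+1) Γ(β/2+k+1))`. At a pole of `Γ` in the denominator
(possible only for `β = 2`) Mathlib's `Γ` is `0`, so that the value is the usual `0`. -/
def gCoeff (β : ℝ) (k : ℤ) : ℝ :=
  (-1 : ℝ) ^ k * Real.Gamma (β + 1)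
    / (Real.Gamma (β / 2 - (k : ℝ) + 1) * Real.Gamma (β / 2 + (k : ℝ) + 1))

/-- `∑_{k = i - M}^{i} g_k^{(β)} v_{i-k}`. -/
def centredDiff (β : ℝ) (M : ℕ) (v : ℤ → ℝ) (i : ℤ) : ℝ :=
  ∑ k ∈ Finset.Icc (i - (M : ℤ)) i, gCoeff β k * v (i - k)

/-- `r_β`. -/
def rConst (β : ℝ) : ℝ :=
  Real.exp (-2) * ((4 - β) * (2 - β) * β / ((6 + β) * (4 + β) * (2 + β)))
    * (Real.Gamma (β + 1) / Real.Gamma (β / 2 + 1) ^ 2) * (3 + β / 2) ^ (β + 1)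

/-- `c_*^{(β)} = (2 / β) r_β`. -/
def cStar (β : ℝ) : ℝ := 2 / β * rConst β

/-! The two-dimensional difference scheme. -/

/-- The source term on the grid, `f_{ij}^{n-1+σ} = f (x_i, y_j, (n - 1 + σ) τ)`. -/
def sourceGrid (f : ℝ → ℝ → ℝ → ℝ) (h₁ h₂ τ σ : ℝ) (n : ℕ) (i j : ℤ) : ℝ :=
  f ((i : ℝ) * h₁) ((j : ℝ) * h₂) (((n : ℝ) - 1 + σ) * τ)

/-- `u n i j` (for `0 ≤ n ≤ N`, `0 ≤ i ≤ M₁`, `0 ≤ j ≤ M₂`; other values are irrelevant) solves the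
two-dimensional difference scheme with step sizes `h₁ = L₁ / M₁`, `h₂ = L₂ / M₂`, `τ = T / N`. -/
structure IsSchemeSolution (L₁ L₂ T K₁ K₂ β γ : ℝ) (w : ℝ → ℝ) (f : ℝ → ℝ → ℝ → ℝ)
    (φ : ℝ → ℝ → ℝ) (J M₁ M₂ N : ℕ) (σ : ℝ) (u : ℕ → ℤ → ℤ → ℝ) : Prop where
  eqn : ∀ n : ℕ, 1 ≤ n → n ≤ N → ∀ i j : ℤ, 1 ≤ i → i ≤ (M₁ : ℤ) - 1 → 1 ≤ j → j ≤ (M₂ : ℤ) - 1 →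
    ∑ k ∈ Finset.range n, cHat J w (T / N) σ n k * (u (n - k) i j - u (n - k - 1) i j) =
      - K₁ * (L₁ / M₁) ^ (-β)
          * centredDiff β M₁ (fun p => σ * u n p j + (1 - σ) * u (n - 1) p j) i
      - K₂ * (L₂ / M₂) ^ (-γ)
          * centredDiff γ M₂ (fun q => σ * u n i q + (1 - σ) * u (n - 1) i q) j
      + sourceGrid f (L₁ / M₁) (L₂ / M₂) (T / N) σ n i j
  boundary : ∀ n : ℕ, n ≤ N → ∀ i j : ℤ, 0 ≤ i → i ≤ (M₁ : ℤ) → 0 ≤ j → j ≤ (M₂ : ℤ) →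
    (i = 0 ∨ i = (M₁ : ℤ) ∨ j = 0 ∨ j = (M₂ : ℤ)) → u n i j = 0
  initial : ∀ i j : ℤ, 1 ≤ i → i ≤ (M₁ : ℤ) - 1 → 1 ≤ j → j ≤ (M₂ : ℤ) - 1 →
    u 0 i j = φ ((i : ℝ) * (L₁ / M₁)) ((j : ℝ) * (L₂ / M₂))

/-- The squared discrete `L₂` norm `‖v‖² = h₁ h₂ ∑_{i=1}^{M₁-1} ∑_{j=1}^{M₂-1} v_{ij}²`. -/
def normSq (h₁ h₂ : ℝ) (M₁ M₂ : ℕ) (v : ℤ → ℤ → ℝ) : ℝ :=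
  h₁ * h₂ * ∑ i ∈ Finset.Icc (1 : ℤ) ((M₁ : ℤ) - 1),
    ∑ j ∈ Finset.Icc (1 : ℤ) ((M₂ : ℤ) - 1), v i j ^ 2

/-- `∑_r λ_r / (T^{α_r} Γ(1 - α_r))`. The node `α_{2J} = 1` contributes `0` by the convention
`1 / Γ(0) = 0`, which agrees with Mathlib's `Γ(0) = 0`, `x / 0 = 0`. -/
def weightSum (J : ℕ) (w : ℝ → ℝ) (T : ℝ) : ℝ :=
  ∑ r ∈ Finset.range (2 * J + 1),
    lam J w r / (T ^ (node J r) * Real.Gamma (1 - node J r))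

end TDRFDE

end

/-!
The scheme is tested against the intermediate value `v = σ uⁿ + (1 - σ) uⁿ⁻¹` in the discrete inner
product.

*Time.* After the polarisation `2⟪y - z, v⟫ = ‖y‖² - ‖z‖² + ‖z - v‖² - ‖y - v‖²`, summation by parts
shows that the remainder terms `‖z - v‖² - ‖y - v‖²` contribute a nonnegative amount as soon as
`ĉ₁ ≥ ĉ₂ ≥ ⋯ > 0` and `(2σ - 1) ĉ₀ ≥ σ² ĉ₁`. The monotonicity reduces to signs of third differences
of powers. In the second condition the difference of the two sides, for a single order `α`, is at
least `σ^(1-α) (2σ - 2 + α) / (2 - α)`, and the weighted sum of these bounds over the orders is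
`2 F(σ) / τ² = 0`. The root satisfies `1/2 < σ ≤ 1`, whence the last coefficient of `ĉ` is at least
half of `∑ λ_r / (T^{α_r} Γ(1 - α_r))`.

*Space.* The matrix `g_{i-j}` has nonpositive off-diagonal entries, and by the two-term recursion of
`g` its row sums are `G i + G (M - i)`, with `G m = -∑_{k ≥ m} g_k` known in closed form. Since
`(m - 1)^β G m` is nondecreasing, `G m` is bounded below by a multiple of `M^{-β}`; diagonal
dominance then makes the matrix coercive with constant `c_* (2M)^{-β}`.

Young's inequality absorbs the source into the coercive term, and
`∑ ĉ_k (‖u^{n-k}‖² - ‖u^{n-k-1}‖²) ≤ C` gives the bound by induction on `n`. The factor `1/4` comes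
from `4 / (A₁ + A₂) ≤ 1 / A₁ + 1 / A₂`.
-/

noncomputable section
namespace TDRFDE

/-! ### Powers -/

theorem rpow_le_tangent {s x y : ℝ} (hs₀ : 0 ≤ s) (hs₁ : s ≤ 1) (hx : 0 < x) (hy : 0 ≤ y) :
    y ^ s ≤ x ^ s + s * x ^ (s - 1) * (y - x) := by
  have hyx : -1 ≤ y / x - 1 := by linarith [div_nonneg hy hx.le]
  have bernoulli := rpow_one_add_le_one_add_mul_self hyx hs₀ hs₁
  rw [add_sub_cancel, Real.div_rpow hy hx.le, div_le_iff₀ (Real.rpow_pos_of_pos hx _)] at bernoulli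
  refine bernoulli.trans_eq ?_
  rw [Real.rpow_sub_one hx.ne']
  field_simp

theorem tangent_le_rpow {s x y : ℝ} (hs : 1 ≤ s) (hx : 0 < x) (hy : 0 ≤ y) :
    x ^ s + s * x ^ (s - 1) * (y - x) ≤ y ^ s := by
  have hyx : -1 ≤ y / x - 1 := by linarith [div_nonneg hy hx.le]
  have bernoulli := one_add_mul_self_le_rpow_one_add hyx hs
  rw [add_sub_cancel, Real.div_rpow hy hx.le, le_div_iff₀ (Real.rpow_pos_of_pos hx _)] at bernoulli
  refine le_of_eq_of_le ?_ bernoulli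
  rw [Real.rpow_sub_one hx.ne']
  field_simp

theorem rpow_sub_one_mul_self (s : ℝ) {x : ℝ} (hx : 0 < x) : x ^ (s - 1) * x = x ^ s := by
  rw [Real.rpow_sub_one hx.ne', div_mul_cancel₀ _ hx.ne']

theorem sub_one_rpow_mul_le {s x : ℝ} (hs₀ : 0 < s) (hs₂ : s ≤ 2) (hx : 1 ≤ x) :
    (x - 1) ^ s * (x + s / 2) ≤ x ^ s * (x - s / 2) := by
  have hx₀ : 0 < x := by linarith
  rcases le_total s 1 with hs₁ | hs₁
  · have tangent : (x - 1) ^ s ≤ x ^ (s - 1) * (x - s) := by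
      have h := rpow_le_tangent hs₀.le hs₁ hx₀ (sub_nonneg.2 hx)
      rw [← rpow_sub_one_mul_self s hx₀] at h
      linarith
    calc (x - 1) ^ s * (x + s / 2) ≤ x ^ (s - 1) * (x - s) * (x + s / 2) := by gcongr
      _ = x ^ s * (x - s / 2) - x ^ (s - 1) * (s ^ 2 / 2) := by
          rw [← rpow_sub_one_mul_self s hx₀]; ring
      _ ≤ x ^ s * (x - s / 2) := sub_le_self _ (by positivity)
  · rcases hx.eq_or_lt with rfl | hx₁
    · rw [sub_self, Real.zero_rpow hs₀.ne', zero_mul, Real.one_rpow]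
      linarith
    · have hx₁ : 0 < x - 1 := sub_pos.2 hx₁
      have tangent : (x - 1) ^ (s - 1) * (x - 1 + s) ≤ x ^ s := by
        have h := tangent_le_rpow hs₁ hx₁ hx₀.le
        rw [← rpow_sub_one_mul_self s hx₁] at h
        linarith
      have hs : 0 ≤ s * (1 - s / 2) := mul_nonneg hs₀.le (by linarith)
      calc (x - 1) ^ s * (x + s / 2)
          ≤ (x - 1) ^ s * (x + s / 2) + (x - 1) ^ (s - 1) * (s * (1 - s / 2)) :=
            le_add_of_nonneg_right (by positivity)
        _ = (x - 1) ^ (s - 1) * (x - 1 + s) * (x - s / 2) := by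
            rw [← rpow_sub_one_mul_self s hx₁]; ring
        _ ≤ x ^ s * (x - s / 2) := mul_le_mul_of_nonneg_right tangent (by linarith)

/-! ### The fractional centred difference -/

theorem inv_Gamma_eq_mul_inv_Gamma_add_one (s : ℝ) :
    (Real.Gamma s)⁻¹ = s * (Real.Gamma (s + 1))⁻¹ := by
  rcases eq_or_ne s 0 with rfl | hs
  · rw [Real.Gamma_zero, inv_zero, zero_mul]
  · rw [Real.Gamma_add_one hs, mul_inv, mul_inv_cancel_left₀ hs]

section CentredDifference

variable {β : ℝ}

theorem gCoeff_neg (β : ℝ) (k : ℤ) : gCoeff β (-k) = gCoeff β k := by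
  have hsign : (-1 : ℝ) ^ (-k) = (-1) ^ k := by rw [zpow_neg, ← inv_zpow, inv_neg_one]
  rw [gCoeff, gCoeff, hsign, mul_comm (Real.Gamma _) (Real.Gamma _), Int.cast_neg, sub_neg_eq_add,
    ← sub_eq_add_neg]

theorem gCoeff_add_one_mul (β : ℝ) (k : ℤ) :
    gCoeff β (k + 1) * (k + 1 + β / 2) = gCoeff β k * (k - β / 2) := by
  have hleft := inv_Gamma_eq_mul_inv_Gamma_add_one (β / 2 - k)
  have hright := inv_Gamma_eq_mul_inv_Gamma_add_one (β / 2 + k + 1)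
  simp only [gCoeff, div_eq_mul_inv _ (_ * _), mul_inv, Int.cast_add, Int.cast_one]
  rw [show β / 2 - (k + 1 : ℝ) + 1 = β / 2 - k by ring, ← add_assoc (β / 2), hleft, hright,
    zpow_add_one₀ (by norm_num)]
  ring

theorem gCoeff_zero_pos (hβ : -1 < β) : 0 < gCoeff β 0 := by
  have h₁ := Real.Gamma_pos_of_pos (show 0 < β + 1 by linarith)
  have h₂ := Real.Gamma_pos_of_pos (show 0 < β / 2 + 1 by linarith)
  simp only [gCoeff, zpow_zero, one_mul, Int.cast_zero, sub_zero, add_zero]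
  positivity

theorem gCoeff_lt_zero (hβ₀ : 0 < β) (hβ₂ : β < 2) {k : ℤ} (hk : 1 ≤ k) : gCoeff β k < 0 := by
  induction k, hk using Int.leInduction with
  | base =>
    have hrec : gCoeff β 1 * (1 + β / 2) = gCoeff β 0 * -(β / 2) := by
      simpa using gCoeff_add_one_mul β 0
    refine neg_of_mul_neg_left (b := 1 + β / 2) ?_ (by linarith)
    rw [hrec]
    exact mul_neg_of_pos_of_neg (gCoeff_zero_pos (by linarith)) (by linarith)
  | succ k hk ih =>
    have hk' : (1 : ℝ) ≤ k := by exact_mod_cast hk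
    refine neg_of_mul_neg_left (b := (k : ℝ) + 1 + β / 2) ?_ (by linarith)
    rw [gCoeff_add_one_mul]
    exact mul_neg_of_neg_of_pos ih (by linarith)

theorem gCoeff_nonpos (hβ₀ : 0 < β) (hβ₂ : β < 2) {k : ℤ} (hk : k ≠ 0) : gCoeff β k ≤ 0 := by
  rcases hk.lt_or_gt with hk | hk
  · rw [← gCoeff_neg]
    exact (gCoeff_lt_zero hβ₀ hβ₂ (by omega)).le
  · exact (gCoeff_lt_zero hβ₀ hβ₂ hk).le

/-- The tail `-∑_{k ≥ m} g_k^{(β)}` of the centred difference coefficients, in the closed form which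
the recursion `gCoeff_add_one_mul` provides; no infinite sum has to be handled. -/
def gTail (β : ℝ) (m : ℤ) : ℝ := -gCoeff β m * (m + β / 2) / β

theorem gTail_add_one (β : ℝ) (m : ℤ) : gTail β (m + 1) = -gCoeff β m * (m - β / 2) / β := by
  rw [gTail, Int.cast_add, Int.cast_one, neg_mul, gCoeff_add_one_mul, neg_mul]

theorem gTail_sub_gTail_add_one (hβ : β ≠ 0) (m : ℤ) :
    gTail β m - gTail β (m + 1) = -gCoeff β m := by
  rw [gTail_add_one, gTail]
  field_simp
  ring

theorem gTail_one_sub (β : ℝ) (m : ℤ) : gTail β (1 - m) = -gTail β m := by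
  rw [sub_eq_neg_add, gTail_add_one, gCoeff_neg, gTail, Int.cast_neg]
  ring

theorem gTail_add_one_mul (β : ℝ) (m : ℤ) :
    gTail β (m + 1) * (m + β / 2) = gTail β m * (m - β / 2) := by
  rw [gTail_add_one, gTail]
  ring

theorem gTail_pos (hβ₀ : 0 < β) (hβ₂ : β < 2) {m : ℤ} (hm : 1 ≤ m) : 0 < gTail β m := by
  have hg := gCoeff_lt_zero hβ₀ hβ₂ hm
  have hm' : (1 : ℝ) ≤ m := by exact_mod_cast hm
  exact div_pos (mul_pos (neg_pos.2 hg) (by linarith)) hβ₀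

theorem gTail_antitoneOn (hβ₀ : 0 < β) (hβ₂ : β < 2) : AntitoneOn (gTail β) (Set.Ici 1) := by
  intro m hm m' _ hmm'
  induction m', hmm' using Int.leInduction with
  | base => exact le_rfl
  | succ k hmk ih =>
    have hk : 1 ≤ k := le_trans hm hmk
    linarith [gTail_sub_gTail_add_one hβ₀.ne' k, gCoeff_lt_zero hβ₀ hβ₂ hk, ih hk]

theorem sub_one_rpow_mul_gTail_le (hβ₀ : 0 < β) (hβ₂ : β < 2) {m : ℤ} (hm : 1 ≤ m) :
    ((m : ℝ) - 1) ^ β * gTail β m ≤ (m : ℝ) ^ β * gTail β (m + 1) := by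
  have hm' : (1 : ℝ) ≤ m := by exact_mod_cast hm
  have hpos : 0 < (m : ℝ) + β / 2 := by linarith
  refine le_of_mul_le_mul_right ?_ hpos
  calc ((m : ℝ) - 1) ^ β * gTail β m * (m + β / 2)
      = gTail β m * (((m : ℝ) - 1) ^ β * (m + β / 2)) := by ring
    _ ≤ gTail β m * ((m : ℝ) ^ β * (m - β / 2)) :=
        mul_le_mul_of_nonneg_left (sub_one_rpow_mul_le hβ₀ hβ₂.le hm') (gTail_pos hβ₀ hβ₂ hm).le
    _ = (m : ℝ) ^ β * gTail β (m + 1) * (m + β / 2) := by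
        rw [mul_assoc, gTail_add_one_mul]; ring

theorem two_rpow_mul_gTail_three_le (hβ₀ : 0 < β) (hβ₂ : β < 2) {m : ℤ} (hm : 3 ≤ m) :
    2 ^ β * gTail β 3 ≤ ((m : ℝ) - 1) ^ β * gTail β m := by
  induction m, hm using Int.leInduction with
  | base => norm_num
  | succ m hm ih =>
    rw [Int.cast_add, Int.cast_one, add_sub_cancel_right]
    exact ih.trans (sub_one_rpow_mul_gTail_le hβ₀ hβ₂ (by omega))

theorem two_div_rpow_mul_gTail_three_le (hβ₀ : 0 < β) (hβ₂ : β < 2) {M : ℕ} {m : ℤ} (hm : 1 ≤ m)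
    (hmM : m < M) : (2 / (M : ℝ)) ^ β * gTail β 3 ≤ gTail β m := by
  have hM₂ : (2 : ℝ) ≤ M := by exact_mod_cast (show 2 ≤ M by omega)
  have hM₀ : (0 : ℝ) < M := by linarith
  have hm' : (1 : ℝ) ≤ m := by exact_mod_cast hm
  have hmM' : (m : ℝ) < M := by exact_mod_cast hmM
  rcases le_total m 3 with hm₃ | hm₃
  · have htail : gTail β 3 ≤ gTail β m :=
      gTail_antitoneOn hβ₀ hβ₂ hm (Set.mem_Ici.2 (by norm_num)) hm₃
    have hpow : (2 / (M : ℝ)) ^ β ≤ 1 :=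
      Real.rpow_le_one (by positivity) ((div_le_one hM₀).2 hM₂) hβ₀.le
    exact (mul_le_of_le_one_left (gTail_pos hβ₀ hβ₂ (by norm_num)).le hpow).trans htail
  · have hpow : ((m : ℝ) - 1) ^ β ≤ (M : ℝ) ^ β :=
      Real.rpow_le_rpow (by linarith) (by linarith) hβ₀.le
    rw [Real.div_rpow zero_le_two hM₀.le, div_mul_eq_mul_div, div_le_iff₀' (by positivity)]
    exact (two_rpow_mul_gTail_three_le hβ₀ hβ₂ hm₃).trans
      (mul_le_mul_of_nonneg_right hpow (gTail_pos hβ₀ hβ₂ hm).le)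

theorem cStar_eq (hβ : 0 < β) :
    cStar β = 2 * Real.exp (-2) * gTail β 3 * (3 + β / 2) ^ β := by
  have hg₀ : Real.Gamma (β + 1) / Real.Gamma (β / 2 + 1) ^ 2 = gCoeff β 0 := by
    simp only [gCoeff, zpow_zero, one_mul, Int.cast_zero, sub_zero, add_zero, sq]
  have hrec₁ : gCoeff β 1 * (1 + β / 2) = gCoeff β 0 * -(β / 2) := by
    simpa using gCoeff_add_one_mul β 0
  have hrec₂ : gCoeff β 2 * (2 + β / 2) = gCoeff β 1 * (1 - β / 2) := by
    simpa [one_add_one_eq_two] using gCoeff_add_one_mul β 1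
  have hrec₃ : gCoeff β 3 * (3 + β / 2) = gCoeff β 2 * (2 - β / 2) := by
    simpa [two_add_one_eq_three] using gCoeff_add_one_mul β 2
  have hg₁ : gCoeff β 1 = -(gCoeff β 0 * β / (2 + β)) := by field_simp; linarith
  have hg₂ : gCoeff β 2 = gCoeff β 1 * (2 - β) / (4 + β) := by field_simp; linarith
  have hg₃ : gCoeff β 3 = gCoeff β 2 * (4 - β) / (6 + β) := by field_simp; linarith
  rw [cStar, rConst, gTail, hg₀, hg₃, hg₂, hg₁, Real.rpow_add_one (by positivity)]
  push_cast
  field_simp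

theorem cStar_pos (hβ₀ : 0 < β) (hβ₂ : β < 2) : 0 < cStar β := by
  have := gTail_pos hβ₀ hβ₂ (show (1 : ℤ) ≤ 3 by norm_num)
  rw [cStar_eq hβ₀]
  positivity

theorem cStar_mul_rpow_le_two_mul_gTail (hβ₀ : 0 < β) (hβ₂ : β < 2) {M : ℕ} {m : ℤ}
    (hm : 1 ≤ m) (hmM : m < M) : cStar β * (2 * (M : ℝ)) ^ (-β) ≤ 2 * gTail β m := by
  have htail₃ : 0 < gTail β 3 := gTail_pos hβ₀ hβ₂ (by norm_num)
  have hM : (0 : ℝ) < M := by exact_mod_cast (show 0 < M by omega)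
  have hexp : Real.exp (-2) ≤ 1 := Real.exp_le_one_iff.2 (by norm_num)
  have hpow : (3 + β / 2) ^ β * (2 * (M : ℝ)) ^ (-β) ≤ (2 / (M : ℝ)) ^ β := by
    rw [Real.rpow_neg (by positivity), ← div_eq_mul_inv,
      ← Real.div_rpow (by positivity) (by positivity)]
    refine Real.rpow_le_rpow (by positivity) ?_ hβ₀.le
    rw [div_le_div_iff₀ (by positivity) hM]
    nlinarith
  calc cStar β * (2 * (M : ℝ)) ^ (-β)
      = 2 * (Real.exp (-2) * ((3 + β / 2) ^ β * (2 * (M : ℝ)) ^ (-β) * gTail β 3)) := by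
        rw [cStar_eq hβ₀]; ring
    _ ≤ 2 * (1 * ((2 / (M : ℝ)) ^ β * gTail β 3)) := by gcongr
    _ ≤ 2 * gTail β m := by
        rw [one_mul]
        exact mul_le_mul_of_nonneg_left (two_div_rpow_mul_gTail_three_le hβ₀ hβ₂ hm hmM) zero_le_two

theorem sum_Icc_gCoeff (hβ : β ≠ 0) (i : ℤ) {m : ℤ} (hm : 0 ≤ m) :
    ∑ j ∈ Finset.Icc 1 m, gCoeff β (i - j) = gTail β i - gTail β (i - m) := by
  induction m, hm using Int.leInduction with
  | base => simp
  | succ m hm ih =>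
    have hIcc : Finset.Icc 1 (m + 1) = insert (m + 1) (Finset.Icc 1 m) := by
      ext x; simp only [Finset.mem_Icc, Finset.mem_insert]; omega
    have hstep := gTail_sub_gTail_add_one hβ (i - (m + 1))
    rw [show i - (m + 1) + 1 = i - m by ring] at hstep
    rw [hIcc, Finset.sum_insert (by simp), ih]
    linarith

theorem centredDiff_eq_sum_interior (β : ℝ) {M : ℕ} {v : ℤ → ℝ} (hv₀ : v 0 = 0) (hvM : v M = 0)
    (i : ℤ) :
    centredDiff β M v i = ∑ j ∈ Finset.Icc (1 : ℤ) ((M : ℤ) - 1), gCoeff β (i - j) * v j := by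
  have hreflect : centredDiff β M v i = ∑ j ∈ Finset.Icc (0 : ℤ) M, gCoeff β (i - j) * v j := by
    refine Finset.sum_nbij' (i - ·) (i - ·) ?_ ?_ ?_ ?_ ?_ <;> intro k hk <;>
      simp only [Finset.mem_Icc, sub_sub_cancel] at hk ⊢ <;> omega
  rw [hreflect]
  refine (Finset.sum_subset (Finset.Icc_subset_Icc (by omega) (by omega)) ?_).symm
  intro j hj hj'
  simp only [Finset.mem_Icc] at hj hj'
  obtain rfl | rfl : j = 0 ∨ j = M := by omega
  · rw [hv₀, mul_zero]
  · rw [hvM, mul_zero]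

theorem le_sum_mul_of_le_rowSum {ι : Type*} (s : Finset ι) {a : ι → ι → ℝ} {c : ℝ}
    (hsymm : ∀ i ∈ s, ∀ j ∈ s, a i j = a j i) (hoff : ∀ i ∈ s, ∀ j ∈ s, i ≠ j → a i j ≤ 0)
    (hrow : ∀ i ∈ s, c ≤ ∑ j ∈ s, a i j) (v : ι → ℝ) :
    c * ∑ i ∈ s, v i ^ 2 ≤ ∑ i ∈ s, (∑ j ∈ s, a i j * v j) * v i := by
  have hpoint : ∀ i ∈ s, ∀ j ∈ s, a i j * (v i ^ 2 + v j ^ 2) / 2 ≤ a i j * v j * v i := by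
    intro i hi j hj
    rcases eq_or_ne i j with rfl | hij
    · exact le_of_eq (by ring)
    · linarith [mul_nonneg (neg_nonneg.2 (hoff i hi j hj hij)) (sq_nonneg (v i - v j))]
  have hswap : ∑ i ∈ s, ∑ j ∈ s, a i j * v j ^ 2 = ∑ i ∈ s, ∑ j ∈ s, a i j * v i ^ 2 := by
    rw [Finset.sum_comm]
    exact Finset.sum_congr rfl fun i hi => Finset.sum_congr rfl fun j hj => by rw [hsymm i hi j hj]
  calc c * ∑ i ∈ s, v i ^ 2 ≤ ∑ i ∈ s, ∑ j ∈ s, a i j * v i ^ 2 := by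
        rw [Finset.mul_sum]
        refine Finset.sum_le_sum fun i hi => ?_
        rw [← Finset.sum_mul]
        exact mul_le_mul_of_nonneg_right (hrow i hi) (sq_nonneg _)
    _ = ∑ i ∈ s, ∑ j ∈ s, a i j * (v i ^ 2 + v j ^ 2) / 2 := by
        simp_rw [mul_add, add_div, Finset.sum_add_distrib, ← Finset.sum_div]
        rw [hswap, add_halves]
    _ ≤ ∑ i ∈ s, ∑ j ∈ s, a i j * v j * v i :=
        Finset.sum_le_sum fun i hi => Finset.sum_le_sum fun j hj => hpoint i hi j hj
    _ = ∑ i ∈ s, (∑ j ∈ s, a i j * v j) * v i := by simp_rw [Finset.sum_mul]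

theorem cStar_mul_sum_sq_le_sum_centredDiff (hβ₀ : 0 < β) (hβ₂ : β < 2) {M : ℕ} {v : ℤ → ℝ}
    (hv₀ : v 0 = 0) (hvM : v M = 0) :
    cStar β * (2 * (M : ℝ)) ^ (-β) * ∑ i ∈ Finset.Icc (1 : ℤ) ((M : ℤ) - 1), v i ^ 2
      ≤ ∑ i ∈ Finset.Icc (1 : ℤ) ((M : ℤ) - 1), centredDiff β M v i * v i := by
  simp_rw [centredDiff_eq_sum_interior β hv₀ hvM]
  refine le_sum_mul_of_le_rowSum _ (a := fun i j => gCoeff β (i - j)) ?_ ?_ ?_ v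
  · intro i _ j _
    rw [← gCoeff_neg, neg_sub]
  · intro i _ j _ hij
    exact gCoeff_nonpos hβ₀ hβ₂ (sub_ne_zero.2 hij)
  · intro i hi
    rw [Finset.mem_Icc] at hi
    have hleft : cStar β * (2 * (M : ℝ)) ^ (-β) ≤ 2 * gTail β i :=
      cStar_mul_rpow_le_two_mul_gTail hβ₀ hβ₂ (by omega) (by omega)
    have hright : cStar β * (2 * (M : ℝ)) ^ (-β) ≤ 2 * gTail β (M - i) :=
      cStar_mul_rpow_le_two_mul_gTail hβ₀ hβ₂ (by omega) (by omega)
    have hrow : ∑ j ∈ Finset.Icc (1 : ℤ) ((M : ℤ) - 1), gCoeff β (i - j)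
        = gTail β i + gTail β (M - i) := by
      rw [sum_Icc_gCoeff hβ₀.ne' i (by omega), show i - ((M : ℤ) - 1) = 1 - (M - i) by ring,
        gTail_one_sub, sub_neg_eq_add]
    rw [hrow]
    linarith

end CentredDifference

/-! ### Finite differences of powers -/

theorem monotoneOn_of_hasDerivAt_nonneg {D : Set ℝ} (hD : Convex ℝ D) {f f' : ℝ → ℝ}
    (hf : ∀ x ∈ D, HasDerivAt f (f' x) x) (hf' : ∀ x ∈ D, 0 ≤ f' x) : MonotoneOn f D :=
  monotoneOn_of_hasDerivWithinAt_nonneg hD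
    (fun x hx => (hf x hx).continuousAt.continuousWithinAt)
    (fun x hx => (hf x (interior_subset hx)).hasDerivWithinAt)
    (fun x hx => hf' x (interior_subset hx))

theorem hasDerivAt_add_rpow (s : ℝ) {c x : ℝ} (hx : 0 < x + c) :
    HasDerivAt (fun y : ℝ => (y + c) ^ s) (s * (x + c) ^ (s - 1)) x := by
  simpa only [one_mul, id_eq] using
    ((hasDerivAt_id x).add_const c).rpow_const (p := s) (Or.inl hx.ne')

section PowerDifferences

variable {s x : ℝ}

theorem rpow_add_rpow_add_two_le (hs₀ : 0 ≤ s) (hs₁ : s ≤ 1) (hx : 0 < x) :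
    x ^ s + (x + 2) ^ s ≤ 2 * (x + 1) ^ s := by
  have concave := (Real.concaveOn_rpow hs₀ hs₁).2 (Set.mem_Ici.2 hx.le)
    (Set.mem_Ici.2 (show 0 ≤ x + 2 by linarith)) one_half_pos.le one_half_pos.le (add_halves 1)
  simp only [smul_eq_mul] at concave
  rw [show 1 / 2 * x + 1 / 2 * (x + 2) = x + 1 by ring] at concave
  linarith

theorem two_mul_add_one_rpow_le (hs : s ≤ 0) (hx : 0 < x) :
    2 * (x + 1) ^ s ≤ x ^ s + (x + 2) ^ s := by
  have logConvex : (x + 1) ^ s * (x + 1) ^ s ≤ x ^ s * (x + 2) ^ s := by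
    rw [← Real.mul_rpow (by positivity) (by positivity), ← Real.mul_rpow hx.le (by positivity)]
    exact Real.rpow_le_rpow_of_nonpos (by positivity) (by linarith) hs
  refine abs_le_of_sq_le_sq' ?_ (by positivity) |>.2
  linarith [four_mul_le_sq_add (x ^ s) ((x + 2) ^ s)]

theorem rpow_third_difference_nonneg (hs₀ : 0 ≤ s) (hs₁ : s ≤ 1) (hx : 0 < x) :
    0 ≤ (x + 3) ^ s - 3 * (x + 2) ^ s + 3 * (x + 1) ^ s - x ^ s := by
  have hmono : MonotoneOn (fun y : ℝ => (y + 2) ^ s - 2 * (y + 1) ^ s + (y + 0) ^ s)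
      (Set.Ioi 0) := by
    refine monotoneOn_of_hasDerivAt_nonneg (convex_Ioi 0) (fun y (hy : 0 < y) =>
      ((hasDerivAt_add_rpow s (by positivity)).sub
        ((hasDerivAt_add_rpow s (by positivity)).const_mul 2)).add
        (hasDerivAt_add_rpow s (by positivity))) (fun y hy => ?_)
    rw [add_zero]
    linarith [mul_le_mul_of_nonneg_left
      (two_mul_add_one_rpow_le (show s - 1 ≤ 0 by linarith) hy) hs₀]
  have hstep := hmono hx (show 0 < x + 1 by positivity) (le_add_of_nonneg_right zero_le_one)
  simp only [add_zero, add_assoc, one_add_one_eq_two,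
    show (1 : ℝ) + 2 = 3 by norm_num] at hstep
  linarith

theorem rpow_third_difference_nonpos (hs₁ : 1 ≤ s) (hs₂ : s ≤ 2) (hx : 0 < x) :
    (x + 3) ^ s - 3 * (x + 2) ^ s + 3 * (x + 1) ^ s - x ^ s ≤ 0 := by
  have hmono : MonotoneOn (fun y : ℝ => 2 * (y + 1) ^ s - (y + 2) ^ s - (y + 0) ^ s)
      (Set.Ioi 0) := by
    refine monotoneOn_of_hasDerivAt_nonneg (convex_Ioi 0) (fun y (hy : 0 < y) =>
      (((hasDerivAt_add_rpow s (by positivity)).const_mul 2).sub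
        (hasDerivAt_add_rpow s (by positivity))).sub
        (hasDerivAt_add_rpow s (by positivity))) (fun y hy => ?_)
    rw [add_zero]
    linarith [mul_le_mul_of_nonneg_left (rpow_add_rpow_add_two_le (sub_nonneg.2 hs₁)
      (show s - 1 ≤ 1 by linarith) hy) (zero_le_one.trans hs₁)]
  have hstep := hmono hx (show 0 < x + 1 by positivity) (le_add_of_nonneg_right zero_le_one)
  simp only [add_zero, add_assoc, one_add_one_eq_two,
    show (1 : ℝ) + 2 = 3 by norm_num] at hstep
  linarith

theorem trapezoid_le_rpow_sub_rpow {y : ℝ} (hs₁ : 1 ≤ s) (hs₂ : s ≤ 2) (hy : 0 < y)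
    (hyx : y ≤ x) :
    s * (x - y) * (x ^ (s - 1) + y ^ (s - 1)) / 2 ≤ x ^ s - y ^ s := by
  have hmono : MonotoneOn
      (fun t : ℝ => (t + 0) ^ s - s * (t - y) * ((t + 0) ^ (s - 1) + y ^ (s - 1)) / 2)
      (Set.Ioi 0) := by
    refine monotoneOn_of_hasDerivAt_nonneg (convex_Ioi 0) (fun t (ht : 0 < t) =>
      (hasDerivAt_add_rpow s (by positivity)).sub
        (((((hasDerivAt_id t).sub_const y).const_mul s).mul
          ((hasDerivAt_add_rpow (s - 1) (by positivity)).add_const (y ^ (s - 1)))).div_const 2))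
      (fun t ht => ?_)
    have tangent := rpow_le_tangent (sub_nonneg.2 hs₁) (by linarith) ht hy.le
    simp only [id_eq, add_zero]
    linarith [mul_le_mul_of_nonneg_left tangent (zero_le_one.trans hs₁)]
  have hstep := hmono hy (hy.trans_le hyx) hyx
  simp only [add_zero, sub_self, mul_zero, zero_mul, zero_div, sub_zero] at hstep
  linarith

theorem le_rpow_mul (hs₀ : 0 ≤ s) (hs₁ : s ≤ 1) (hx : 0 < x) : x ≤ x ^ s * (s + (1 - s) * x) := by
  have tangent := mul_le_mul_of_nonneg_right (rpow_le_tangent hs₀ hs₁ hx zero_le_one) hx.le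
  rw [Real.one_rpow, one_mul, add_mul, mul_right_comm, mul_assoc s, rpow_sub_one_mul_self s hx]
    at tangent
  linarith

theorem mul_one_sub_rpow_le {u : ℝ} (hs₀ : 0 ≤ s) (hs₁ : s ≤ 1) (hu₀ : 0 < u) (hu₁ : u ≤ 2 / 3) :
    (2 - (3 + s) * u) * (1 - u) ^ s
      ≤ (2 - (3 + s) * u) * (1 - s * u) + u ^ 3 * (2 - u) * (s * (1 - s)) := by
  have hu : 0 < 1 - u := by linarith
  have hss : 0 ≤ s * (1 - s) := mul_nonneg hs₀ (by linarith)
  rcases le_total 0 (2 - (3 + s) * u) with hcoeff | hcoeff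
  · have tangent := rpow_le_tangent hs₀ hs₁ one_pos hu.le
    rw [Real.one_rpow, Real.one_rpow] at tangent
    refine le_add_of_le_of_nonneg (mul_le_mul_of_nonneg_left (by linarith) hcoeff) ?_
    exact mul_nonneg (mul_nonneg (by positivity) (by linarith)) hss
  · set p := s + (1 - s) * (1 - u) with hp
    have hp₀ : 0 < p := by linarith [mul_nonneg hs₀ hu₀.le]
    have hpow : 1 - u ≤ (1 - u) ^ s * p := le_rpow_mul hs₀ hs₁ hu
    have hfactor : 0 ≤ p * (u * (2 - u)) + (2 - (3 + s) * u) := by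
      have h₀ : 0 ≤ 2 - u - 3 * u ^ 2 + u ^ 3 := by nlinarith [mul_pos hu₀ hu₀]
      have h₁ : 0 ≤ 2 - 2 * u - u ^ 2 := by nlinarith
      linarith [mul_nonneg (show 0 ≤ 1 - s by linarith) h₀, mul_nonneg hs₀ h₁]
    refine le_of_mul_le_mul_right ?_ hp₀
    calc (2 - (3 + s) * u) * (1 - u) ^ s * p
        = (2 - (3 + s) * u) * ((1 - u) ^ s * p) := mul_assoc _ _ _
      _ ≤ (2 - (3 + s) * u) * (1 - u) := mul_le_mul_of_nonpos_left hpow hcoeff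
      _ ≤ (2 - (3 + s) * u) * (1 - u)
            + s * (1 - s) * u ^ 2 * (p * (u * (2 - u)) + (2 - (3 + s) * u)) :=
          le_add_of_nonneg_right (by positivity)
      _ = _ := by rw [hp]; ring

theorem one_add_rpow_add_one_sub_rpow_le {u : ℝ} (hs₀ : 0 ≤ s) (hs₁ : s ≤ 1) (hu₀ : 0 < u)
    (hu₁ : u ≤ 2 / 3) :
    (1 - u) ^ 2 * (2 + (1 - s) * u) * (1 + u) ^ s + (2 - (3 + s) * u) * (1 - u) ^ s
      ≤ (2 - 2 * u - u ^ 2) * (2 - (1 + s) * u) := by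
  have : 0 ≤ 1 - s := sub_nonneg.2 hs₁
  have bernoulli : (1 + u) ^ s ≤ 1 + s * u :=
    rpow_one_add_le_one_add_mul_self (by linarith) hs₀ hs₁
  calc _ ≤ (1 - u) ^ 2 * (2 + (1 - s) * u) * (1 + s * u)
        + ((2 - (3 + s) * u) * (1 - s * u) + u ^ 3 * (2 - u) * (s * (1 - s))) :=
        add_le_add (mul_le_mul_of_nonneg_left bernoulli (by positivity))
          (mul_one_sub_rpow_le hs₀ hs₁ hu₀ hu₁)
    _ = (2 - 2 * u - u ^ 2) * (2 - (1 + s) * u) := by ring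

end PowerDifferences

/-! ### The time coefficients of a single order -/

section TimeCoefficients

variable {σ α : ℝ}

theorem aCoeff_of_ne_zero (σ α : ℝ) {l : ℕ} (hl : l ≠ 0) :
    aCoeff σ α l = ((l : ℝ) + σ) ^ (1 - α) - ((l : ℝ) - 1 + σ) ^ (1 - α) :=
  if_neg hl

theorem bCoeff_nonneg (hσ : 0 < σ) (hα : α ∈ Set.Icc (0 : ℝ) 1) {l : ℕ} (hl : l ≠ 0) :
    0 ≤ bCoeff σ α l := by
  have hl₁ : (1 : ℝ) ≤ l := Nat.one_le_cast.2 (Nat.one_le_iff_ne_zero.2 hl)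
  have hα₂ : 0 < 2 - α := by linarith [hα.2]
  have trapezoid := trapezoid_le_rpow_sub_rpow (s := 2 - α) (by linarith [hα.2])
    (by linarith [hα.1]) (show 0 < (l : ℝ) - 1 + σ by linarith)
    (show (l : ℝ) - 1 + σ ≤ l + σ by linarith)
  rw [show 2 - α - 1 = 1 - α by ring, show (l : ℝ) + σ - (l - 1 + σ) = 1 by ring, mul_one,
    mul_div_assoc, ← le_div_iff₀' hα₂] at trapezoid
  rw [bCoeff, one_div_mul_eq_div, one_div_mul_eq_div]
  linarith

theorem le_aCoeff_sub_bCoeff (hσ : 0 < σ) (hα : α ∈ Set.Icc (0 : ℝ) 1) {l : ℕ} (hl : l ≠ 0) :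
    (1 - α) / 2 * ((l : ℝ) + σ) ^ (-α) ≤ aCoeff σ α l - bCoeff σ α l := by
  obtain ⟨hα₀, hα₁⟩ := hα
  have hl₁ : (1 : ℝ) ≤ l := Nat.one_le_cast.2 (Nat.one_le_iff_ne_zero.2 hl)
  have hx : 0 < (l : ℝ) + σ := by linarith
  have hy : 0 ≤ (l : ℝ) - 1 + σ := by linarith
  have hyx : (l : ℝ) - 1 + σ - (l + σ) = -1 := by ring
  have concave := rpow_le_tangent (s := 1 - α) (by linarith) (by linarith) hx hy
  have convex := tangent_le_rpow (s := 2 - α) (by linarith) hx hy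
  rw [hyx, show 1 - α - 1 = -α by ring] at concave
  rw [hyx, show 2 - α - 1 = 1 - α by ring] at convex
  have hmean : 1 / (2 - α) * (((l : ℝ) + σ) ^ (2 - α) - ((l : ℝ) - 1 + σ) ^ (2 - α))
      ≤ ((l : ℝ) + σ) ^ (1 - α) := by
    rw [one_div_mul_eq_div, div_le_iff₀ (by linarith)]
    linarith
  rw [aCoeff_of_ne_zero σ α hl, bCoeff]
  linarith

theorem cCoeff_succ_zero (σ α : ℝ) {n : ℕ} (hn : n ≠ 0) :
    cCoeff σ α (n + 1) 0 = aCoeff σ α 0 + bCoeff σ α 1 := by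
  rw [cCoeff, if_neg (by omega), if_pos rfl]

theorem cCoeff_succ_of_lt (σ α : ℝ) {n k : ℕ} (hk : k ≠ 0) (hkn : k < n) :
    cCoeff σ α (n + 1) k = aCoeff σ α k + bCoeff σ α (k + 1) - bCoeff σ α k := by
  rw [cCoeff, if_neg (by omega), if_neg hk, if_pos (by omega)]

theorem cCoeff_succ_self (σ α : ℝ) {n : ℕ} (hn : n ≠ 0) :
    cCoeff σ α (n + 1) n = aCoeff σ α n - bCoeff σ α n := by
  rw [cCoeff, if_neg (by omega), if_neg hn, if_neg (by omega)]

theorem cCoeff_succ_le (hσ : 0 < σ) (hα : α ∈ Set.Icc (0 : ℝ) 1) {n k : ℕ} (hk : k ≠ 0)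
    (hkn : k ≤ n) :
    cCoeff σ α (n + 1) k ≤ aCoeff σ α k + bCoeff σ α (k + 1) - bCoeff σ α k := by
  rcases hkn.eq_or_lt with rfl | hkn
  · rw [cCoeff_succ_self σ α hk]
    linarith [bCoeff_nonneg hσ hα (Nat.succ_ne_zero k)]
  · exact (cCoeff_succ_of_lt σ α hk hkn).le

theorem aCoeff_bCoeff_difference_le (hσ : 0 < σ) (hα : α ∈ Set.Icc (0 : ℝ) 1) {k : ℕ}
    (hk : k ≠ 0) :
    aCoeff σ α (k + 1) + bCoeff σ α (k + 2) - bCoeff σ α (k + 1)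
      ≤ aCoeff σ α k + bCoeff σ α (k + 1) - bCoeff σ α k := by
  obtain ⟨hα₀, hα₁⟩ := hα
  have hk₁ : (1 : ℝ) ≤ k := Nat.one_le_cast.2 (Nat.one_le_iff_ne_zero.2 hk)
  obtain ⟨x, hx⟩ : ∃ x, x = (k : ℝ) - 1 + σ := ⟨_, rfl⟩
  have hx₀ : 0 < x := by linarith
  have hlow := rpow_third_difference_nonneg (s := 1 - α) (by linarith) (by linarith) hx₀
  have hhigh := mul_nonpos_of_nonneg_of_nonpos (show 0 ≤ 1 / (2 - α) by
    rw [one_div_nonneg]; linarith) (rpow_third_difference_nonpos (s := 2 - α) (by linarith)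
    (by linarith) hx₀)
  rw [aCoeff_of_ne_zero σ α hk, aCoeff_of_ne_zero σ α (Nat.succ_ne_zero k), bCoeff, bCoeff, bCoeff]
  push_cast
  rw [show (k : ℝ) + 2 + σ = x + 3 by linarith, show (k : ℝ) + 1 + σ = x + 2 by linarith,
    show (k : ℝ) + 2 - 1 + σ = x + 2 by linarith, show (k : ℝ) + 1 - 1 + σ = x + 1 by linarith,
    show (k : ℝ) + σ = x + 1 by linarith, ← hx]
  linarith

theorem cCoeff_succ_add_one_le (hσ : 0 < σ) (hα : α ∈ Set.Icc (0 : ℝ) 1) {n k : ℕ} (hk : k ≠ 0)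
    (hkn : k < n) : cCoeff σ α (n + 1) (k + 1) ≤ cCoeff σ α (n + 1) k := by
  rw [cCoeff_succ_of_lt σ α hk hkn]
  exact (cCoeff_succ_le hσ hα (Nat.succ_ne_zero k) hkn).trans
    (aCoeff_bCoeff_difference_le hσ hα hk)

theorem le_cCoeff_succ_self (hσ : 1 / 2 ≤ σ) (hα : α ∈ Set.Icc (0 : ℝ) 1) (n : ℕ) :
    (1 - α) / 2 * ((n : ℝ) + σ) ^ (-α) ≤ cCoeff σ α (n + 1) n := by
  have hσ₀ : 0 < σ := by linarith
  rcases eq_or_ne n 0 with rfl | hn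
  · rw [cCoeff, if_pos rfl, aCoeff, if_pos rfl, Nat.cast_zero, zero_add, sub_eq_add_neg,
      Real.rpow_add hσ₀, Real.rpow_one, ← sub_eq_add_neg]
    exact mul_le_mul_of_nonneg_right (by linarith [hα.1]) (Real.rpow_nonneg hσ₀.le _)
  · rw [cCoeff_succ_self σ α hn]
    exact le_aCoeff_sub_bCoeff hσ₀ hα hn

theorem consecutive_rpow_le (hσ : 1 / 2 ≤ σ) (hα : α ∈ Set.Icc (0 : ℝ) 1) :
    σ ^ 2 * (2 + 2 * σ + α) * (2 + σ) ^ (1 - α) + (1 + σ) ^ 2 * (2 * σ - 2 + α) * σ ^ (1 - α)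
      ≤ (2 * σ ^ 2 + 2 * σ - 1) * (2 * σ + α) * (1 + σ) ^ (1 - α) := by
  have hσ₀ : 0 < σ := by linarith
  have hx : 0 < 1 + σ := by linarith
  have scaled := mul_le_mul_of_nonneg_left
    (one_add_rpow_add_one_sub_rpow_le (s := 1 - α) (u := 1 / (1 + σ)) (by linarith [hα.2])
      (by linarith [hα.1]) (by positivity) (by rw [div_le_div_iff₀ hx three_pos]; linarith))
    (show 0 ≤ (1 + σ) ^ (1 - α) * (1 + σ) ^ 3 by positivity)
  have hsub : 1 - 1 / (1 + σ) = σ / (1 + σ) := by field_simp; ring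
  have hadd : 1 + 1 / (1 + σ) = (2 + σ) / (1 + σ) := by field_simp; ring
  have hpow : 0 < (1 + σ) ^ (1 - α) := by positivity
  rw [hsub, hadd, Real.div_rpow hσ₀.le hx.le, Real.div_rpow (by positivity) hx.le] at scaled
  generalize (1 + σ) ^ (1 - α) = x at *
  generalize (2 + σ) ^ (1 - α) = y at *
  generalize σ ^ (1 - α) = z at *
  field_simp at scaled
  linarith

theorem le_two_mul_sub_one_mul_cCoeff_zero_sub (hσ : 1 / 2 ≤ σ) (hα : α ∈ Set.Icc (0 : ℝ) 1)
    {n : ℕ} (hn : n ≠ 0) :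
    σ ^ (1 - α) * (2 * σ - 2 + α) / (2 - α)
      ≤ (2 * σ - 1) * cCoeff σ α (n + 1) 0 - σ ^ 2 * cCoeff σ α (n + 1) 1 := by
  have hσ₀ : 0 < σ := by linarith
  have hα₂ : 0 < 2 - α := by linarith [hα.2]
  have hone := mul_le_mul_of_nonneg_left
    (cCoeff_succ_le hσ₀ hα one_ne_zero (Nat.one_le_iff_ne_zero.2 hn)) (sq_nonneg σ)
  have hsplit (y : ℝ) (hy : 0 < y) : y ^ (2 - α) = y * y ^ (1 - α) := by
    rw [show 2 - α = 1 + (1 - α) by ring, Real.rpow_add hy, Real.rpow_one]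
  have hconsec := div_nonneg (sub_nonneg.2 (consecutive_rpow_le hσ hα))
    (show 0 ≤ 2 * (2 - α) by linarith)
  refine le_trans ?_ (sub_le_sub_left hone _)
  rw [cCoeff_succ_zero σ α hn, aCoeff_of_ne_zero σ α one_ne_zero, bCoeff, bCoeff, aCoeff,
    if_pos rfl]
  simp only [Nat.cast_one, Nat.cast_ofNat, one_add_one_eq_two, sub_self, zero_add,
    show (2 : ℝ) - 1 = 1 by norm_num]
  rw [← sub_nonneg, hsplit σ hσ₀, hsplit (1 + σ) (by positivity), hsplit (2 + σ) (by positivity)]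
  refine hconsec.trans_eq ?_
  field_simp
  ring

end TimeCoefficients

/-! ### The energy method for a decreasing kernel -/

theorem mul_sub_mul_le_sum_range_mul_sub {n : ℕ} {c e : ℕ → ℝ} (hc : ∀ k < n, c (k + 1) ≤ c k)
    (he : ∀ k < n, 0 ≤ e (k + 1)) :
    c n * e (n + 1) - c 0 * e 0 ≤ ∑ k ∈ Finset.range (n + 1), c k * (e (k + 1) - e k) := by
  induction n with
  | zero => rw [Finset.sum_range_one, mul_sub]
  | succ n ih =>
    rw [Finset.sum_range_succ]
    linarith [ih (fun k hk => hc k (by omega)) (fun k hk => he k (by omega)),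
      mul_le_mul_of_nonneg_right (hc n n.lt_succ_self) (he n n.lt_succ_self)]

theorem le_add_of_sum_range_mul_sub_le {n : ℕ} {c a : ℕ → ℝ} {D : ℝ}
    (hc : ∀ k < n, c (k + 1) ≤ c k) (hc₀ : 0 < c 0) (ha : ∀ l ≤ n, a l ≤ a 0 + D)
    (hsum : ∑ k ∈ Finset.range (n + 1), c k * (a (n + 1 - k) - a (n - k)) ≤ c n * D) :
    a (n + 1) ≤ a 0 + D := by
  have hparts := mul_sub_mul_le_sum_range_mul_sub (e := fun k => a 0 + D - a (n + 1 - k)) hc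
    (fun k _ => sub_nonneg.2 (ha _ (by omega)))
  simp only [Nat.add_sub_add_right, sub_sub_sub_cancel_left, Nat.sub_self, Nat.sub_zero,
    add_sub_cancel_left] at hparts
  have hfirst : 0 ≤ c 0 * (a 0 + D - a (n + 1)) := by linarith
  exact sub_nonneg.1 (nonneg_of_mul_nonneg_right hfirst hc₀)

/-- The conditions on the coefficients `c 0, …, c n` of a discrete time derivative
`∑_{k ≤ n} c k (u^{n+1-k} - u^{n-k})` under which it satisfies an energy inequality when tested
against the intermediate value `σ u^{n+1} + (1 - σ) u^n`. -/
structure IsAlikhanovKernel (σ : ℝ) (n : ℕ) (c : ℕ → ℝ) : Prop where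
  succ_le_of_ne_zero : ∀ k, k ≠ 0 → k < n → c (k + 1) ≤ c k
  sq_mul_one_le : n ≠ 0 → σ ^ 2 * c 1 ≤ (2 * σ - 1) * c 0
  last_pos : 0 < c n

namespace IsAlikhanovKernel

variable {σ : ℝ} {n : ℕ} {c : ℕ → ℝ}

theorem pos_of_ne_zero (hc : IsAlikhanovKernel σ n c) {k : ℕ} (hk : k ≠ 0) (hkn : k ≤ n) :
    0 < c k := by
  induction hkn using Nat.decreasingInduction with
  | self => exact hc.last_pos
  | of_succ k hkn ih => exact (ih k.succ_ne_zero).trans_le (hc.succ_le_of_ne_zero k hk hkn)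

theorem zero_pos (hc : IsAlikhanovKernel σ n c) (hσ : 1 / 2 ≤ σ) : 0 < c 0 := by
  rcases eq_or_ne n 0 with rfl | hn
  · exact hc.last_pos
  · have hone := hc.pos_of_ne_zero one_ne_zero (Nat.one_le_iff_ne_zero.2 hn)
    have hprod : 0 < (2 * σ - 1) * c 0 :=
      (mul_pos (by positivity) hone).trans_le (hc.sq_mul_one_le hn)
    exact pos_of_mul_pos_right hprod (by linarith)

theorem succ_le (hc : IsAlikhanovKernel σ n c) (hσ : 1 / 2 ≤ σ) : ∀ k < n, c (k + 1) ≤ c k := by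
  intro k hkn
  rcases eq_or_ne k 0 with rfl | hk
  · have hσ₂ : 2 * σ - 1 ≤ σ ^ 2 := by linarith [sq_nonneg (σ - 1)]
    exact le_of_mul_le_mul_left ((hc.sq_mul_one_le hkn.ne').trans
      (mul_le_mul_of_nonneg_right hσ₂ (hc.zero_pos hσ).le)) (by positivity)
  · exact hc.succ_le_of_ne_zero k hk hkn

variable {E : Type*} [NormedAddCommGroup E] [InnerProductSpace ℝ E]

theorem sum_mul_norm_sub_sq_nonneg (hc : IsAlikhanovKernel σ n c) (hσ : 1 / 2 ≤ σ) (y : ℕ → E) :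
    0 ≤ ∑ k ∈ Finset.range (n + 1), c k * (‖y (k + 1) - (σ • y 0 + (1 - σ) • y 1)‖ ^ 2
      - ‖y k - (σ • y 0 + (1 - σ) • y 1)‖ ^ 2) := by
  set v := σ • y 0 + (1 - σ) • y 1 with hv
  have hzero : ‖y 0 - v‖ ^ 2 = (1 - σ) ^ 2 * ‖y 0 - y 1‖ ^ 2 := by
    rw [show y 0 - v = (1 - σ) • (y 0 - y 1) by rw [hv]; module, norm_smul, mul_pow,
      Real.norm_eq_abs, sq_abs]
  have hone : ‖y 1 - v‖ ^ 2 = σ ^ 2 * ‖y 0 - y 1‖ ^ 2 := by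
    rw [show y 1 - v = -(σ • (y 0 - y 1)) by rw [hv]; module, norm_neg, norm_smul, mul_pow,
      Real.norm_eq_abs, sq_abs]
  have hfirst : c 0 * (‖y 1 - v‖ ^ 2 - ‖y 0 - v‖ ^ 2) = (2 * σ - 1) * c 0 * ‖y 0 - y 1‖ ^ 2 := by
    rw [hzero, hone]; ring
  cases n with
  | zero =>
    rw [Finset.sum_range_one, hfirst]
    exact mul_nonneg (mul_nonneg (by linarith) hc.last_pos.le) (sq_nonneg _)
  | succ n =>
    have hparts := mul_sub_mul_le_sum_range_mul_sub (n := n) (c := fun k => c (k + 1))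
      (e := fun k => ‖y (k + 1) - v‖ ^ 2)
      (fun k hk => hc.succ_le_of_ne_zero _ k.succ_ne_zero (by omega)) (fun k _ => sq_nonneg _)
    have hlast : 0 ≤ c (n + 1) * ‖y (n + 1 + 1) - v‖ ^ 2 :=
      mul_nonneg hc.last_pos.le (sq_nonneg _)
    have hratio := mul_le_mul_of_nonneg_right (hc.sq_mul_one_le n.succ_ne_zero)
      (sq_nonneg ‖y 0 - y 1‖)
    rw [Finset.sum_range_succ', hfirst]
    simp only [zero_add, hone] at hparts
    linarith

theorem half_sum_mul_norm_sq_sub_le (hc : IsAlikhanovKernel σ n c) (hσ : 1 / 2 ≤ σ) (y : ℕ → E) :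
    1 / 2 * ∑ k ∈ Finset.range (n + 1), c k * (‖y k‖ ^ 2 - ‖y (k + 1)‖ ^ 2)
      ≤ inner ℝ (∑ k ∈ Finset.range (n + 1), c k • (y k - y (k + 1)))
          (σ • y 0 + (1 - σ) • y 1) := by
  have hnonneg := hc.sum_mul_norm_sub_sq_nonneg hσ y
  set v := σ • y 0 + (1 - σ) • y 1
  have hpolar (k : ℕ) : c k * (‖y (k + 1) - v‖ ^ 2 - ‖y k - v‖ ^ 2)
      = 2 * inner ℝ (c k • (y k - y (k + 1))) v - c k * (‖y k‖ ^ 2 - ‖y (k + 1)‖ ^ 2) := by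
    rw [norm_sub_sq_real, norm_sub_sq_real, real_inner_smul_left, inner_sub_left]
    ring
  simp_rw [hpolar, Finset.sum_sub_distrib, ← Finset.mul_sum, ← sum_inner] at hnonneg
  linarith

theorem sum_mul_norm_sq_sub_le (hc : IsAlikhanovKernel σ n c) (hσ : 1 / 2 ≤ σ) {A : ℝ}
    (hA : 0 < A) {y : ℕ → E} {b g : E}
    (heq : ∑ k ∈ Finset.range (n + 1), c k • (y k - y (k + 1)) = -b + g)
    (hb : A * ‖σ • y 0 + (1 - σ) • y 1‖ ^ 2 ≤ inner ℝ b (σ • y 0 + (1 - σ) • y 1)) :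
    ∑ k ∈ Finset.range (n + 1), c k * (‖y k‖ ^ 2 - ‖y (k + 1)‖ ^ 2) ≤ ‖g‖ ^ 2 / (2 * A) := by
  have henergy := hc.half_sum_mul_norm_sq_sub_le hσ y
  rw [heq, inner_add_left, inner_neg_left] at henergy
  set v := σ • y 0 + (1 - σ) • y 1
  have hyoung : ‖g‖ * ‖v‖ ≤ ‖g‖ ^ 2 / (2 * A) / 2 + A * ‖v‖ ^ 2 := by
    have hsq : ‖g‖ ^ 2 / (2 * A) / 2 + A * ‖v‖ ^ 2 - ‖g‖ * ‖v‖
        = (‖g‖ - 2 * A * ‖v‖) ^ 2 / (4 * A) := by field_simp; ring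
    exact sub_nonneg.1 (hsq ▸ by positivity)
  linarith [real_inner_le_norm g v]

theorem norm_sq_le_of_forall_sum_eq {W A G : ℝ} {N : ℕ} {c : ℕ → ℕ → ℝ}
    (hc : ∀ n < N, IsAlikhanovKernel σ n (c n)) (hσ : 1 / 2 ≤ σ) (hW : 0 < W)
    (hcW : ∀ n < N, W ≤ c n n) (hA : 0 < A) (hG : 0 ≤ G) {u b g : ℕ → E}
    (heq : ∀ n < N, ∑ k ∈ Finset.range (n + 1), c n k • (u (n + 1 - k) - u (n - k)) = -b n + g n)
    (hb : ∀ n < N, A * ‖σ • u (n + 1) + (1 - σ) • u n‖ ^ 2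
      ≤ inner ℝ (b n) (σ • u (n + 1) + (1 - σ) • u n))
    (hg : ∀ n < N, ‖g n‖ ^ 2 ≤ G) {n : ℕ} (hn : n ≤ N) :
    ‖u n‖ ^ 2 ≤ ‖u 0‖ ^ 2 + G / (2 * A * W) := by
  have hD : 0 ≤ G / (2 * A * W) := by positivity
  induction n using Nat.strong_induction_on with
  | _ n ih =>
    cases n with
    | zero => exact le_add_of_nonneg_right hD
    | succ n =>
      have henergy := (hc n hn).sum_mul_norm_sq_sub_le hσ hA (y := fun k => u (n + 1 - k))
        (by simpa only [Nat.add_sub_add_right] using heq n hn) (hb n hn)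
      refine le_add_of_sum_range_mul_sub_le (a := fun l => ‖u l‖ ^ 2) ((hc n hn).succ_le hσ)
        ((hc n hn).zero_pos hσ) (fun l hl => ih l (by omega) (by omega)) ?_
      simp only [Nat.add_sub_add_right] at henergy
      calc _ ≤ ‖g n‖ ^ 2 / (2 * A) := henergy
        _ ≤ G / (2 * A) := by gcongr; exact hg n hn
        _ = W * (G / (2 * A * W)) := by field_simp
        _ ≤ c n n * (G / (2 * A * W)) := mul_le_mul_of_nonneg_right (hcW n hn) hD

end IsAlikhanovKernel

/-! ### The distributed order kernel -/

section DistributedOrder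

variable {J r : ℕ} {w : ℝ → ℝ} {τ σ : ℝ}

theorem node_mem_Icc (hr : r ≤ 2 * J) : node J r ∈ Set.Icc (0 : ℝ) 1 :=
  ⟨by unfold node; positivity, div_le_one_of_le₀ (by exact_mod_cast hr) (by positivity)⟩

theorem node_lt_one (hr : r < 2 * J) : node J r < 1 := by
  have hJ : (0 : ℝ) < J := Nat.cast_pos.2 (by omega)
  exact (div_lt_one (by positivity)).2 (by exact_mod_cast hr)

theorem trapWeight_pos (J r : ℕ) : 0 < trapWeight J r := by
  unfold trapWeight
  split_ifs <;> norm_num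

theorem lam_nonneg (hw : 0 ≤ w (node J r)) : 0 ≤ lam J w r :=
  mul_nonneg (mul_nonneg (trapWeight_pos J r).le hw) (by positivity)

theorem lam_pos (hJ : 0 < J) (hw : 0 < w (node J r)) : 0 < lam J w r :=
  mul_pos (mul_pos (trapWeight_pos J r) hw) (by positivity)

theorem weightSum_pos (hw : ∀ r ≤ 2 * J, 0 ≤ w (node J r))
    (hw' : ∃ r : ℕ, r < 2 * J ∧ 0 < w (node J r)) {T : ℝ} (hT : 0 < T) : 0 < weightSum J w T := by
  obtain ⟨r₀, hr₀, hwr₀⟩ := hw'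
  refine Finset.sum_pos' (fun r hr => ?_) ⟨r₀, by rw [Finset.mem_range]; omega, ?_⟩
  · have hr : r ≤ 2 * J := Finset.mem_range_succ_iff.1 hr
    have hΓ := Real.Gamma_nonneg_of_nonneg (sub_nonneg.2 (node_mem_Icc hr).2)
    have hlam := lam_nonneg (hw r hr)
    positivity
  · have hΓ := Real.Gamma_pos_of_pos (sub_pos.2 (node_lt_one hr₀))
    have hlam := lam_pos (by omega) hwr₀
    positivity

/-- The weight `λ_r τ^{-α_r} / Γ(2 - α_r)` with which the order `α_r` enters `ĉ_k`. -/
def orderWeight (J : ℕ) (w : ℝ → ℝ) (τ : ℝ) (r : ℕ) : ℝ :=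
  lam J w r * (τ ^ (-node J r) / Real.Gamma (2 - node J r))

theorem orderWeight_nonneg (hτ : 0 ≤ τ) (hr : r ≤ 2 * J) (hw : 0 ≤ w (node J r)) :
    0 ≤ orderWeight J w τ r := by
  have hΓ := Real.Gamma_nonneg_of_nonneg (show 0 ≤ 2 - node J r by linarith [(node_mem_Icc hr).2])
  exact mul_nonneg (lam_nonneg hw) (by positivity)

theorem orderWeight_pos (hτ : 0 < τ) (hr : r < 2 * J) (hw : 0 < w (node J r)) :
    0 < orderWeight J w τ r := by
  have hΓ := Real.Gamma_pos_of_pos (show 0 < 2 - node J r by linarith [node_lt_one hr])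
  exact mul_pos (lam_pos (by omega) hw) (by positivity)

theorem cHat_eq_sum_orderWeight (J : ℕ) (w : ℝ → ℝ) (τ σ : ℝ) (n k : ℕ) :
    cHat J w τ σ n k
      = ∑ r ∈ Finset.range (2 * J + 1), orderWeight J w τ r * cCoeff σ (node J r) n k := rfl

theorem F_eq_sum_orderWeight (hτ : 0 < τ) :
    F J w τ σ = τ ^ 2 / 2 * ∑ r ∈ Finset.range (2 * J + 1),
      orderWeight J w τ r * (σ ^ (1 - node J r) * (2 * σ - 2 + node J r) / (2 - node J r)) := by
  rw [F, Finset.mul_sum]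
  refine Finset.sum_congr rfl fun r hr => ?_
  have hα₂ : 0 < 2 - node J r := by
    linarith [(node_mem_Icc (Finset.mem_range_succ_iff.1 hr)).2]
  have hΓ := (Real.Gamma_pos_of_pos hα₂).ne'
  rw [show 3 - node J r = 2 - node J r + 1 by ring, Real.Gamma_add_one hα₂.ne',
    show τ ^ (2 - node J r) = τ ^ 2 * τ ^ (-node J r) by
      rw [sub_eq_add_neg, Real.rpow_add hτ, Real.rpow_two], orderWeight]
  field_simp
  ring

theorem F_neg_of_le_half (hw : ∀ r ≤ 2 * J, 0 ≤ w (node J r))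
    (hw' : ∃ r : ℕ, r < 2 * J ∧ 0 < w (node J r)) (hτ : 0 < τ) (hσ₀ : 0 < σ) (hσ : σ ≤ 1 / 2) :
    F J w τ σ < 0 := by
  obtain ⟨r₀, hr₀, hwr₀⟩ := hw'
  rw [F_eq_sum_orderWeight hτ]
  refine mul_neg_of_pos_of_neg (by positivity)
    (Finset.sum_neg' (fun r hr => ?_) ⟨r₀, Finset.mem_range_succ_iff.2 hr₀.le, ?_⟩)
  · have hr : r ≤ 2 * J := Finset.mem_range_succ_iff.1 hr
    have hα := node_mem_Icc hr
    exact mul_nonpos_of_nonneg_of_nonpos (orderWeight_nonneg hτ.le hr (hw r hr))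
      (div_nonpos_of_nonpos_of_nonneg (mul_nonpos_of_nonneg_of_nonpos
        (Real.rpow_nonneg hσ₀.le _) (by linarith [hα.2])) (by linarith [hα.2]))
  · have hα := node_lt_one hr₀
    exact mul_neg_of_pos_of_neg (orderWeight_pos hτ hr₀ hwr₀) (div_neg_of_neg_of_pos
      (mul_neg_of_pos_of_neg (Real.rpow_pos_of_pos hσ₀ _) (by linarith)) (by linarith))

theorem F_pos_of_one_lt (hw : ∀ r ≤ 2 * J, 0 ≤ w (node J r))
    (hw' : ∃ r : ℕ, r < 2 * J ∧ 0 < w (node J r)) (hτ : 0 < τ) (hσ : 1 < σ) :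
    0 < F J w τ σ := by
  obtain ⟨r₀, hr₀, hwr₀⟩ := hw'
  have hfactor (r : ℕ) (hr : r ≤ 2 * J) :
      0 < σ ^ (1 - node J r) * (2 * σ - 2 + node J r) / (2 - node J r) := by
    obtain ⟨hα₀, hα₁⟩ := node_mem_Icc hr
    exact div_pos (mul_pos (Real.rpow_pos_of_pos (by linarith) _) (by linarith)) (by linarith)
  rw [F_eq_sum_orderWeight hτ]
  refine mul_pos (by positivity)
    (Finset.sum_pos' (fun r hr => ?_) ⟨r₀, Finset.mem_range_succ_iff.2 hr₀.le, ?_⟩)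
  · have hr : r ≤ 2 * J := Finset.mem_range_succ_iff.1 hr
    exact mul_nonneg (orderWeight_nonneg hτ.le hr (hw r hr)) (hfactor r hr).le
  · exact mul_pos (orderWeight_pos hτ hr₀ hwr₀) (hfactor r₀ hr₀.le)

theorem mem_Ioc_of_F_eq_zero (hw : ∀ r ≤ 2 * J, 0 ≤ w (node J r))
    (hw' : ∃ r : ℕ, r < 2 * J ∧ 0 < w (node J r)) (hτ : 0 < τ) (hσ : 0 < σ)
    (hF : F J w τ σ = 0) : σ ∈ Set.Ioc (1 / 2) 1 :=
  ⟨not_le.1 fun h => (F_neg_of_le_half hw hw' hτ hσ h).ne hF,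
    not_lt.1 fun h => (F_pos_of_one_lt hw hw' hτ h).ne' hF⟩

theorem cHat_succ_add_one_le (hw : ∀ r ≤ 2 * J, 0 ≤ w (node J r)) (hτ : 0 ≤ τ) (hσ : 0 < σ)
    {n k : ℕ} (hk : k ≠ 0) (hkn : k < n) :
    cHat J w τ σ (n + 1) (k + 1) ≤ cHat J w τ σ (n + 1) k := by
  rw [cHat_eq_sum_orderWeight, cHat_eq_sum_orderWeight]
  refine Finset.sum_le_sum fun r hr => ?_
  have hr : r ≤ 2 * J := Finset.mem_range_succ_iff.1 hr
  exact mul_le_mul_of_nonneg_left (cCoeff_succ_add_one_le hσ (node_mem_Icc hr) hk hkn)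
    (orderWeight_nonneg hτ hr (hw r hr))

theorem two_mul_F_div_sq_le (hw : ∀ r ≤ 2 * J, 0 ≤ w (node J r)) (hτ : 0 < τ) (hσ : 1 / 2 ≤ σ)
    {n : ℕ} (hn : n ≠ 0) :
    2 * F J w τ σ / τ ^ 2
      ≤ (2 * σ - 1) * cHat J w τ σ (n + 1) 0 - σ ^ 2 * cHat J w τ σ (n + 1) 1 := by
  have hscale (x : ℝ) : 2 * (τ ^ 2 / 2 * x) / τ ^ 2 = x := by field_simp
  rw [F_eq_sum_orderWeight hτ, hscale, cHat_eq_sum_orderWeight, cHat_eq_sum_orderWeight,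
    Finset.mul_sum, Finset.mul_sum, ← Finset.sum_sub_distrib]
  refine Finset.sum_le_sum fun r hr => ?_
  have hr : r ≤ 2 * J := Finset.mem_range_succ_iff.1 hr
  rw [mul_left_comm, mul_left_comm (σ ^ 2), ← mul_sub]
  exact mul_le_mul_of_nonneg_left
    (le_two_mul_sub_one_mul_cCoeff_zero_sub hσ (node_mem_Icc hr) hn)
    (orderWeight_nonneg hτ.le hr (hw r hr))

theorem lam_div_le_orderWeight_mul_cCoeff (hτ : 0 < τ) (hσ : σ ∈ Set.Ioc (1 / 2) 1) {T : ℝ} {n : ℕ}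
    (hnT : ((n : ℝ) + 1) * τ ≤ T) (hr : r ≤ 2 * J) (hw : 0 ≤ w (node J r)) :
    lam J w r / (T ^ node J r * Real.Gamma (1 - node J r)) / 2
      ≤ orderWeight J w τ r * cCoeff σ (node J r) (n + 1) n := by
  have hα := node_mem_Icc hr
  refine le_trans ?_ (mul_le_mul_of_nonneg_left (le_cCoeff_succ_self hσ.1.le hα n)
    (orderWeight_nonneg hτ.le hr hw))
  rcases hα.2.eq_or_lt with hα₁ | hα₁
  · rw [hα₁, sub_self, Real.Gamma_zero, mul_zero, div_zero, zero_div, zero_mul, mul_zero]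
  · have hσ₀ : 0 < σ := one_half_pos.trans hσ.1
    have hx : 0 < (n : ℝ) + σ := by positivity
    have hxT : τ * ((n : ℝ) + σ) ≤ T :=
      (mul_comm τ _).trans_le ((mul_le_mul_of_nonneg_right (by linarith [hσ.2]) hτ.le).trans hnT)
    have hT : 0 < T := (mul_pos hτ hx).trans_le hxT
    have hs : 0 < 1 - node J r := sub_pos.2 hα₁
    have := Real.Gamma_pos_of_pos hs
    have hlam := lam_nonneg hw
    have hpow : T ^ (-node J r) ≤ τ ^ (-node J r) * ((n : ℝ) + σ) ^ (-node J r) := by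
      rw [← Real.mul_rpow hτ.le hx.le]
      exact Real.rpow_le_rpow_of_nonpos (mul_pos hτ hx) hxT (neg_nonpos.2 hα.1)
    rw [orderWeight, show 2 - node J r = 1 - node J r + 1 by ring, Real.Gamma_add_one hs.ne']
    calc lam J w r / (T ^ node J r * Real.Gamma (1 - node J r)) / 2
        = lam J w r / (2 * Real.Gamma (1 - node J r)) * T ^ (-node J r) := by
          rw [Real.rpow_neg hT.le]; field_simp
      _ ≤ lam J w r / (2 * Real.Gamma (1 - node J r))
          * (τ ^ (-node J r) * ((n : ℝ) + σ) ^ (-node J r)) := by gcongr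
      _ = _ := by field_simp

theorem half_weightSum_le_cHat_succ_self (hw : ∀ r ≤ 2 * J, 0 ≤ w (node J r)) (hτ : 0 < τ)
    (hσ : σ ∈ Set.Ioc (1 / 2) 1) {T : ℝ} {n : ℕ} (hnT : ((n : ℝ) + 1) * τ ≤ T) :
    weightSum J w T / 2 ≤ cHat J w τ σ (n + 1) n := by
  rw [cHat_eq_sum_orderWeight, weightSum, Finset.sum_div]
  refine Finset.sum_le_sum fun r hr => ?_
  have hr : r ≤ 2 * J := Finset.mem_range_succ_iff.1 hr
  exact lam_div_le_orderWeight_mul_cCoeff hτ hσ hnT hr (hw r hr)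

theorem isAlikhanovKernel_cHat (hw : ∀ r ≤ 2 * J, 0 ≤ w (node J r))
    (hw' : ∃ r : ℕ, r < 2 * J ∧ 0 < w (node J r)) (hτ : 0 < τ) (hσ : 0 < σ)
    (hF : F J w τ σ = 0) (n : ℕ) : IsAlikhanovKernel σ n (cHat J w τ σ (n + 1)) where
  succ_le_of_ne_zero _ hk hkn := cHat_succ_add_one_le hw hτ.le hσ hk hkn
  sq_mul_one_le hn := by
    have hdiff := two_mul_F_div_sq_le hw hτ (mem_Ioc_of_F_eq_zero hw hw' hτ hσ hF).1.le hn
    rw [hF, mul_zero, zero_div] at hdiff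
    exact sub_nonneg.1 hdiff
  last_pos :=
    (half_pos (weightSum_pos hw hw' (mul_pos n.cast_add_one_pos hτ))).trans_le
      (half_weightSum_le_cHat_succ_self hw hτ (mem_Ioc_of_F_eq_zero hw hw' hτ hσ hF) le_rfl)

end DistributedOrder

/-! ### The spatial grid -/

/-- The values of a grid function at the interior nodes, scaled by `√(h₁ h₂)` so that the Euclidean
norm becomes the discrete `L₂` norm. -/
def gridVector (h₁ h₂ : ℝ) (M₁ M₂ : ℕ) : (ℤ → ℤ → ℝ) →ₗ[ℝ] EuclideanSpace ℝ
    (Finset.Icc (1 : ℤ) ((M₁ : ℤ) - 1) × Finset.Icc (1 : ℤ) ((M₂ : ℤ) - 1)) where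
  toFun v := WithLp.toLp 2 fun x => √(h₁ * h₂) * v x.1 x.2
  map_add' v v' := by
    ext x
    exact mul_add _ _ _
  map_smul' a v := by
    ext x
    exact mul_left_comm _ _ _

/-- The discrete operator `-K₁ ∂_x^β - K₂ ∂_y^γ` of the scheme, with Riesz derivatives replaced by
fractional centred differences. -/
def discreteDiffusion (K₁ K₂ h₁ h₂ β γ : ℝ) (M₁ M₂ : ℕ) (v : ℤ → ℤ → ℝ) (i j : ℤ) : ℝ :=
  K₁ * h₁ ^ (-β) * centredDiff β M₁ (fun p => v p j) i
    + K₂ * h₂ ^ (-γ) * centredDiff γ M₂ (fun q => v i q) j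

/-- The homogeneous Dirichlet condition on the boundary of the `M₁ × M₂` grid. -/
def VanishesOnBoundary (M₁ M₂ : ℕ) (v : ℤ → ℤ → ℝ) : Prop :=
  ∀ i j : ℤ, 0 ≤ i → i ≤ (M₁ : ℤ) → 0 ≤ j → j ≤ (M₂ : ℤ) →
    (i = 0 ∨ i = (M₁ : ℤ) ∨ j = 0 ∨ j = (M₂ : ℤ)) → v i j = 0

section Grid

variable {h₁ h₂ β γ K₁ K₂ : ℝ} {M₁ M₂ : ℕ} {v : ℤ → ℤ → ℝ}

theorem inner_gridVector (hh : 0 ≤ h₁ * h₂) (v v' : ℤ → ℤ → ℝ) :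
    inner ℝ (gridVector h₁ h₂ M₁ M₂ v) (gridVector h₁ h₂ M₁ M₂ v')
      = h₁ * h₂ * ∑ i ∈ Finset.Icc (1 : ℤ) ((M₁ : ℤ) - 1),
          ∑ j ∈ Finset.Icc (1 : ℤ) ((M₂ : ℤ) - 1), v i j * v' i j := by
  have hsqrt (x y : ℝ) : √(h₁ * h₂) * y * (√(h₁ * h₂) * x) = h₁ * h₂ * (x * y) := by
    rw [mul_mul_mul_comm, Real.mul_self_sqrt hh, mul_comm y]
  simp_rw [Finset.mul_sum, ← hsqrt]
  rw [PiLp.inner_apply, Fintype.sum_prod_type,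
    ← Finset.sum_coe_sort (Finset.Icc (1 : ℤ) ((M₁ : ℤ) - 1))]
  refine Finset.sum_congr rfl fun i _ => ?_
  rw [← Finset.sum_coe_sort (Finset.Icc (1 : ℤ) ((M₂ : ℤ) - 1))]
  rfl

theorem normSq_eq_norm_gridVector_sq (hh : 0 ≤ h₁ * h₂) (v : ℤ → ℤ → ℝ) :
    normSq h₁ h₂ M₁ M₂ v = ‖gridVector h₁ h₂ M₁ M₂ v‖ ^ 2 := by
  simp_rw [← real_inner_self_eq_norm_sq, inner_gridVector hh, ← sq, normSq]

theorem normSq_nonneg (hh : 0 ≤ h₁ * h₂) (v : ℤ → ℤ → ℝ) : 0 ≤ normSq h₁ h₂ M₁ M₂ v :=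
  (sq_nonneg _).trans_eq (normSq_eq_norm_gridVector_sq hh v).symm

theorem VanishesOnBoundary.add {v' : ℤ → ℤ → ℝ} (hv : VanishesOnBoundary M₁ M₂ v)
    (hv' : VanishesOnBoundary M₁ M₂ v') : VanishesOnBoundary M₁ M₂ (v + v') :=
  fun i j hi hi' hj hj' h => by
    rw [Pi.add_apply, Pi.add_apply, hv i j hi hi' hj hj' h, hv' i j hi hi' hj hj' h, add_zero]

theorem VanishesOnBoundary.smul (a : ℝ) (hv : VanishesOnBoundary M₁ M₂ v) :
    VanishesOnBoundary M₁ M₂ (a • v) :=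
  fun i j hi hi' hj hj' h => by
    rw [Pi.smul_apply, Pi.smul_apply, hv i j hi hi' hj hj' h, smul_zero]

theorem mul_sum_sq_le_sum_mul_centredDiff (hβ₀ : 0 < β) (hβ₂ : β < 2) {K L : ℝ} (hK : 0 ≤ K)
    (hL : 0 < L) {M : ℕ} (hM : 1 ≤ M) {v : ℤ → ℝ} (hv₀ : v 0 = 0) (hvM : v M = 0) :
    K * cStar β / (2 * L) ^ β * ∑ i ∈ Finset.Icc (1 : ℤ) ((M : ℤ) - 1), v i ^ 2
      ≤ ∑ i ∈ Finset.Icc (1 : ℤ) ((M : ℤ) - 1),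
          K * (L / M) ^ (-β) * centredDiff β M v i * v i := by
  have : (0 : ℝ) < M := Nat.cast_pos.2 hM
  have hpow : (L / M) ^ (-β) * (2 * (M : ℝ)) ^ (-β) = ((2 * L) ^ β)⁻¹ := by
    rw [← Real.mul_rpow (by positivity) (by positivity), ← Real.rpow_neg (by positivity)]
    congr 1
    field_simp
  simp_rw [div_eq_mul_inv _ ((2 * L) ^ β), ← hpow, mul_assoc (K * _), ← Finset.mul_sum]
  refine le_of_eq_of_le ?_ (mul_le_mul_of_nonneg_left
    (cStar_mul_sum_sq_le_sum_centredDiff hβ₀ hβ₂ hv₀ hvM)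
    (show 0 ≤ K * (L / M) ^ (-β) by positivity))
  ring

theorem mul_norm_sq_le_inner_discreteDiffusion (hβ₀ : 0 < β) (hβ₂ : β < 2) (hγ₀ : 0 < γ)
    (hγ₂ : γ < 2) {L₁ L₂ : ℝ} (hL₁ : 0 < L₁) (hL₂ : 0 < L₂) (hK₁ : 0 ≤ K₁) (hK₂ : 0 ≤ K₂)
    (hM₁ : 1 ≤ M₁) (hM₂ : 1 ≤ M₂) (hv : VanishesOnBoundary M₁ M₂ v) :
    (K₁ * cStar β / (2 * L₁) ^ β + K₂ * cStar γ / (2 * L₂) ^ γ)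
        * ‖gridVector (L₁ / M₁) (L₂ / M₂) M₁ M₂ v‖ ^ 2
      ≤ inner ℝ (gridVector (L₁ / M₁) (L₂ / M₂) M₁ M₂
            (discreteDiffusion K₁ K₂ (L₁ / M₁) (L₂ / M₂) β γ M₁ M₂ v))
          (gridVector (L₁ / M₁) (L₂ / M₂) M₁ M₂ v) := by
  have hh : 0 ≤ L₁ / M₁ * (L₂ / M₂) := by positivity
  have hx := Finset.sum_le_sum fun j (hj : j ∈ Finset.Icc (1 : ℤ) ((M₂ : ℤ) - 1)) =>
    mul_sum_sq_le_sum_mul_centredDiff hβ₀ hβ₂ hK₁ hL₁ hM₁ (v := fun p => v p j)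
      (hv 0 j le_rfl (by omega) (by grind) (by grind) (by omega))
      (hv M₁ j (by omega) le_rfl (by grind) (by grind) (by omega))
  have hy := Finset.sum_le_sum fun i (hi : i ∈ Finset.Icc (1 : ℤ) ((M₁ : ℤ) - 1)) =>
    mul_sum_sq_le_sum_mul_centredDiff hγ₀ hγ₂ hK₂ hL₂ hM₂ (v := v i)
      (hv i 0 (by grind) (by grind) le_rfl (by omega) (by omega))
      (hv i M₂ (by grind) (by grind) (by omega) le_rfl (by omega))
  rw [← Finset.mul_sum, Finset.sum_comm, Finset.sum_comm (s := Finset.Icc 1 ((M₂ : ℤ) - 1))] at hx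
  rw [← Finset.mul_sum] at hy
  rw [← normSq_eq_norm_gridVector_sq hh, normSq, inner_gridVector hh, mul_left_comm]
  refine mul_le_mul_of_nonneg_left ?_ hh
  simp_rw [discreteDiffusion, add_mul, Finset.sum_add_distrib]
  exact add_le_add hx hy

theorem IsSchemeSolution.sum_smul_gridVector_eq {L₁ L₂ T : ℝ} {w : ℝ → ℝ}
    {f : ℝ → ℝ → ℝ → ℝ} {φ : ℝ → ℝ → ℝ} {J N : ℕ} {σ : ℝ} {u : ℕ → ℤ → ℤ → ℝ}
    (hu : IsSchemeSolution L₁ L₂ T K₁ K₂ β γ w f φ J M₁ M₂ N σ u) {n : ℕ} (hn : n < N) :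
    ∑ k ∈ Finset.range (n + 1), cHat J w (T / N) σ (n + 1) k
        • (gridVector h₁ h₂ M₁ M₂ (u (n + 1 - k)) - gridVector h₁ h₂ M₁ M₂ (u (n - k)))
      = -gridVector h₁ h₂ M₁ M₂ (discreteDiffusion K₁ K₂ (L₁ / M₁) (L₂ / M₂) β γ M₁ M₂
            (σ • u (n + 1) + (1 - σ) • u n))
        + gridVector h₁ h₂ M₁ M₂ (sourceGrid f (L₁ / M₁) (L₂ / M₂) (T / N) σ (n + 1)) := by
  simp only [← map_sub, ← map_smul, ← map_sum, ← map_neg, ← map_add]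
  ext ⟨⟨i, hi⟩, ⟨j, hj⟩⟩
  rw [Finset.mem_Icc] at hi hj
  have hscheme := hu.eqn (n + 1) n.succ_pos hn i j hi.1 hi.2 hj.1 hj.2
  refine congrArg (√(h₁ * h₂) * ·) ?_
  simp only [Nat.add_sub_add_right, Nat.sub_sub, Nat.add_sub_cancel] at hscheme
  simp only [Finset.sum_apply, Pi.smul_apply, Pi.sub_apply, Pi.add_apply, Pi.neg_apply,
    smul_eq_mul, discreteDiffusion]
  rw [hscheme]
  ring

theorem IsSchemeSolution.normSq_le {L₁ L₂ T : ℝ} {w : ℝ → ℝ} {f : ℝ → ℝ → ℝ → ℝ} {φ : ℝ → ℝ → ℝ}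
    {J N : ℕ} {σ : ℝ} {u : ℕ → ℤ → ℤ → ℝ}
    (hu : IsSchemeSolution L₁ L₂ T K₁ K₂ β γ w f φ J M₁ M₂ N σ u)
    (hL₁ : 0 < L₁) (hL₂ : 0 < L₂) (hT : 0 < T) (hK₁ : 0 < K₁) (hK₂ : 0 < K₂)
    (hβ₀ : 0 < β) (hβ₂ : β < 2) (hγ₀ : 0 < γ) (hγ₂ : γ < 2) (hM₁ : 1 ≤ M₁) (hM₂ : 1 ≤ M₂)
    (hw : ∀ r ≤ 2 * J, 0 ≤ w (node J r)) (hw' : ∃ r : ℕ, r < 2 * J ∧ 0 < w (node J r))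
    (hσ : 0 < σ) (hF : F J w (T / N) σ = 0) {n : ℕ} (hn : n ≠ 0) (hnN : n ≤ N) {G : ℝ}
    (hG : ∀ l ∈ Finset.Icc 1 n, normSq (L₁ / M₁) (L₂ / M₂) M₁ M₂
      (sourceGrid f (L₁ / M₁) (L₂ / M₂) (T / N) σ l) ≤ G) :
    normSq (L₁ / M₁) (L₂ / M₂) M₁ M₂ (u n) ≤ normSq (L₁ / M₁) (L₂ / M₂) M₁ M₂ (u 0)
      + (K₁ * cStar β / (2 * L₁) ^ β + K₂ * cStar γ / (2 * L₂) ^ γ)⁻¹ / weightSum J w T * G := by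
  have hN : (0 : ℝ) < N := Nat.cast_pos.2 (by omega)
  have hτ : 0 < T / N := div_pos hT hN
  have hh : 0 ≤ L₁ / M₁ * (L₂ / M₂) := by positivity
  have hσ' := mem_Ioc_of_F_eq_zero hw hw' hτ hσ hF
  have hA : 0 < K₁ * cStar β / (2 * L₁) ^ β + K₂ * cStar γ / (2 * L₂) ^ γ := by
    have := cStar_pos hβ₀ hβ₂
    have := cStar_pos hγ₀ hγ₂
    positivity
  have htime {l : ℕ} (hl : l < n) : ((l : ℝ) + 1) * (T / N) ≤ T := by
    have hlN : (l : ℝ) + 1 ≤ N := by exact_mod_cast hl.trans_le hnN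
    rw [mul_div_left_comm]
    exact mul_le_of_le_one_right hT.le ((div_le_one hN).2 hlN)
  have hcoercive {l : ℕ} (hl : l < n) := mul_norm_sq_le_inner_discreteDiffusion hβ₀ hβ₂ hγ₀ hγ₂
    hL₁ hL₂ hK₁.le hK₂.le hM₁ hM₂ (v := σ • u (l + 1) + (1 - σ) • u l)
    (.add (.smul σ (hu.boundary _ (by omega))) (.smul (1 - σ) (hu.boundary _ (by omega))))
  simp only [map_add, map_smul] at hcoercive
  simp_rw [normSq_eq_norm_gridVector_sq hh] at hG ⊢
  have hsource (l : ℕ) (hl : l < n) := hG (l + 1) (Finset.mem_Icc.2 ⟨l.succ_pos, hl⟩)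
  have hstable := IsAlikhanovKernel.norm_sq_le_of_forall_sum_eq
    (u := fun l => gridVector (L₁ / M₁) (L₂ / M₂) M₁ M₂ (u l))
    (fun l _ => isAlikhanovKernel_cHat hw hw' hτ hσ hF l) hσ'.1.le
    (half_pos (weightSum_pos hw hw' hT))
    (fun l hl => half_weightSum_le_cHat_succ_self hw hτ hσ' (htime hl)) hA
    ((sq_nonneg _).trans (hsource 0 (Nat.pos_of_ne_zero hn)))
    (fun l hl => hu.sum_smul_gridVector_eq (hl.trans_le hnN)) (fun l hl => hcoercive hl) hsource
    le_rfl
  refine hstable.trans_eq (congrArg (_ + ·) ?_)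
  have := (weightSum_pos hw hw' hT).ne'
  field_simp

end Grid

theorem inv_add_le {a b : ℝ} (ha : 0 < a) (hb : 0 < b) : (a + b)⁻¹ ≤ 1 / 4 * (a⁻¹ + b⁻¹) := by
  rw [inv_add_inv ha.ne' hb.ne', mul_div_assoc', inv_eq_one_div,
    div_le_div_iff₀ (by positivity) (by positivity)]
  linarith [four_mul_le_sq_add a b]

end TDRFDE

end

theorem mainTheorem5_general
    (L₁ L₂ T K₁ K₂ β γ : ℝ)
    (hL₁ : 0 < L₁) (hL₂ : 0 < L₂) (hT : 0 < T) (hK₁ : 0 < K₁) (hK₂ : 0 < K₂)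
    (hβ : 0 < β) (hβ' : β < 2) (hγ : 0 < γ) (hγ' : γ < 2)
    (J M₁ M₂ N : ℕ) (hM₁ : 1 ≤ M₁) (hM₂ : 1 ≤ M₂)
    (w : ℝ → ℝ) (hw : ∀ r ≤ 2 * J, 0 ≤ w (TDRFDE.node J r))
    (hw' : ∃ r : ℕ, r < 2 * J ∧ 0 < w (TDRFDE.node J r))
    (f : ℝ → ℝ → ℝ → ℝ) (φ : ℝ → ℝ → ℝ)
    (σ : ℝ) (hσ : 0 < σ) (hF : TDRFDE.F J w (T / N) σ = 0)
    (u : ℕ → ℤ → ℤ → ℝ)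
    (hu : TDRFDE.IsSchemeSolution L₁ L₂ T K₁ K₂ β γ w f φ J M₁ M₂ N σ u)
    (n : ℕ) (hn : 1 ≤ n) (hnN : n ≤ N) :
    TDRFDE.normSq (L₁ / M₁) (L₂ / M₂) M₁ M₂ (u n) ≤
      TDRFDE.normSq (L₁ / M₁) (L₂ / M₂) M₁ M₂ (u 0)
        + 1 / 4 * ((2 * L₁) ^ β / (K₁ * TDRFDE.cStar β) + (2 * L₂) ^ γ / (K₂ * TDRFDE.cStar γ))
          / TDRFDE.weightSum J w T
          * (Finset.Icc 1 n).sup' (Finset.nonempty_Icc.mpr hn) (fun l =>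
              TDRFDE.normSq (L₁ / M₁) (L₂ / M₂) M₁ M₂
                (TDRFDE.sourceGrid f (L₁ / M₁) (L₂ / M₂) (T / N) σ l)) := by
  open TDRFDE in
  have hW := weightSum_pos hw hw' hT
  have hcβ := cStar_pos hβ hβ'
  have hcγ := cStar_pos hγ hγ'
  have hmean := inv_add_le (show 0 < K₁ * cStar β / (2 * L₁) ^ β by positivity)
    (show 0 < K₂ * cStar γ / (2 * L₂) ^ γ by positivity)
  rw [inv_div, inv_div] at hmean
  refine (hu.normSq_le hL₁ hL₂ hT hK₁ hK₂ hβ hβ' hγ hγ' hM₁ hM₂ hw hw' hσ hF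
    (Nat.one_le_iff_ne_zero.1 hn) hnN
    ((Finset.sup'_le_iff (Finset.nonempty_Icc.mpr hn) fun l => normSq (L₁ / M₁) (L₂ / M₂) M₁ M₂
      (sourceGrid f (L₁ / M₁) (L₂ / M₂) (T / N) σ l)).1 le_rfl)).trans ?_
  gcongr
  exact Finset.le_sup'_of_le _ (Finset.mem_Icc.2 ⟨le_rfl, hn⟩) (normSq_nonneg (by positivity) _)

theorem mainTheorem5
    (L₁ L₂ T K₁ K₂ β γ : ℝ)
    (hL₁ : 0 < L₁) (hL₂ : 0 < L₂) (hT : 0 < T) (hK₁ : 0 < K₁) (hK₂ : 0 < K₂)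
    (hβ : 1 < β) (hβ' : β < 2) (hγ : 1 < γ) (hγ' : γ < 2)
    (J M₁ M₂ N : ℕ) (hJ : 1 ≤ J) (hM₁ : 1 ≤ M₁) (hM₂ : 1 ≤ M₂) (hN : 1 ≤ N)
    (w : ℝ → ℝ) (hw : ∀ α ∈ Set.Icc (0 : ℝ) 1, 0 ≤ w α)
    (hw' : ∃ r : ℕ, r < 2 * J ∧ 0 < w (TDRFDE.node J r))
    (f : ℝ → ℝ → ℝ → ℝ) (φ : ℝ → ℝ → ℝ)
    (σ : ℝ) (hσ : 0 < σ) (hF : TDRFDE.F J w (T / N) σ = 0)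
    (u : ℕ → ℤ → ℤ → ℝ)
    (hu : TDRFDE.IsSchemeSolution L₁ L₂ T K₁ K₂ β γ w f φ J M₁ M₂ N σ u)
    (n : ℕ) (hn : 1 ≤ n) (hnN : n ≤ N) :
    TDRFDE.normSq (L₁ / M₁) (L₂ / M₂) M₁ M₂ (u n) ≤
      TDRFDE.normSq (L₁ / M₁) (L₂ / M₂) M₁ M₂ (u 0)
        + 1 / 4 * ((2 * L₁) ^ β / (K₁ * TDRFDE.cStar β) + (2 * L₂) ^ γ / (K₂ * TDRFDE.cStar γ))
          / TDRFDE.weightSum J w T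
          * (Finset.Icc 1 n).sup' (Finset.nonempty_Icc.mpr hn) (fun l =>
              TDRFDE.normSq (L₁ / M₁) (L₂ / M₂) M₁ M₂
                (TDRFDE.sourceGrid f (L₁ / M₁) (L₂ / M₂) (T / N) σ l)) :=
  mainTheorem5_general L₁ L₂ T K₁ K₂ β γ hL₁ hL₂ hT hK₁ hK₂ (by linarith) hβ' (by linarith) hγ'
    J M₁ M₂ N hM₁ hM₂ w (fun _ hr => hw _ (TDRFDE.node_mem_Icc hr)) hw' f φ σ hσ hF u hu n hn hnN
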